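/- All indices in $[1:5]=\{1,\dots,5\}$ are taken modulo $5$. A *5-triangulation* is a plane map (a connected graph embedded in the plane) $G$ whose outer face contour is a simple cycle of length $5$, with outer vertices $v_1,\dots,v_5$ in clockwise order, and whose inner faces all have degree $3$; it is a *5c-triangulation* if every cycle with at least one vertex in its interior has length at least $5$. Vertices not among $v_1,\dots,v_5$, and (directed) arcs of edges not on the outer contour, are called *inner*. A *5c-wood* of $G$ is a tuple $(W_1,\dots,W_5)$ of disjoint sets of inner arcs (arcs in $W_i$ have *color* $i$) such that: - (W0) no arc of $W_1\cup\dots\cup W_5$ starts at an outer vertex, and those ending at $v_i$ have color $i$; - (W1) every inner vertex has exactly one outgoing arc of each color $1,\dots,5$, and these arcs appear in clockwise order around it; - (W2) if $v$ is an inner vertex with outgoing arcs $a_1,\dots,a_5$ of colors $1,\dots,5$, then every arc of color $i$ ending at $v$ appears weakly between $a_{i+2}$ and $a_{i+3}$ in clockwise order around $v$ (weakly: it may be opposite to $a_{i+2}$ or $a_{i+3}$); - (W3) at least one of the two arcs of every inner edge has a color. For an inner vertex $v$, let $P_i(v)$ be the directed path from $v$ to $v_i$ in $W_i$, and let $R_i(v)$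 be the closed region enclosed by the simple cycle made of the outer edge $\{v_{i+2},v_{i-2}\}$ and the paths $P_{i-2}(v)$ and $P_{i+2}(v)$. For outer vertices, let $R_i(v_i)=G$ and $R_i(v_j)=\{v_j\}$ for $j\ne i$. Let $|R_i(v)|$ be the number of inner faces in $R_i(v)$, and $\alpha_i(v)=|R_i(v)|/(2n-7)$, where $n$ is the number of vertices of $G$. The associated *5c-barycentric drawing* places $v_1,\dots,v_5$ at the vertices of a regular pentagon, in clockwise order, and places each vertex $v$ of $G$ at the barycenter $\sum_{i=1}^5\alpha_i(v)\,v_i$. **Lemma.** Let $G$ be a 5c-triangulation endowed with a 5c-wood. In the associated 5c-barycentric drawing, for $i\in[1:5]$ let $\overrightarrow{V_i}$ be the vector from the center of the outer pentagon to $v_i$. Then for any vertices $u\neq v$ of $G$ (inner or outer) such that $u\in R_i(v)$, one has $\overrightarrow{V_i}\cdot\overrightarrow{vu}<0$, where $\overrightarrow{vu}$ is the vector from $v$ to $u$ in the drawing. -/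

import Mathlib

/-- A finite combinatorial map (rotation system): `D` is the set of arcs (edges with a choice of
direction; loops and multiple edges are allowed), `rev` sends an arc to the opposite arc, and `rot`
sends an arc to the next arc, in clockwise order, among the arcs with the same initial vertex. -/
structure CombMap (D : Type*) where
  finite : Finite D
  rot : Equiv.Perm D
  rev : Equiv.Perm D
  rev_rev : ∀ d, rev (rev d) = d
  rev_ne : ∀ d, rev d ≠ d

namespace CombMap

variable {D : Type*} (M : CombMap D)

/-- The permutation whose cycles are the faces: the arc following `d` along the boundary of the
face on the left of `d` is the clockwise successor of the arc opposite to `d`. -/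
def facePerm : Equiv.Perm D := M.rot * M.rev

/-- Vertices: the cycles of `rot`. -/
def Vertex : Type _ := Quotient (Equiv.Perm.SameCycle.setoid M.rot)

/-- Edges: the cycles of `rev`. -/
def Edge : Type _ := Quotient (Equiv.Perm.SameCycle.setoid M.rev)

/-- Faces: the cycles of `facePerm`. -/
def Face : Type _ := Quotient (Equiv.Perm.SameCycle.setoid M.facePerm)

/-- The initial vertex of an arc. -/
def origin (d : D) : M.Vertex := Quotient.mk (Equiv.Perm.SameCycle.setoid M.rot) d

/-- The terminal vertex of an arc. -/
def target (d : D) : M.Vertex := M.origin (M.rev d)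

/-- The face on the left of an arc. -/
def leftFace (d : D) : M.Face := Quotient.mk (Equiv.Perm.SameCycle.setoid M.facePerm) d

/-- A plane map: the underlying graph is connected, and the map has genus zero
(Euler's relation `|V| - |E| + |F| = 2`). -/
structure IsPlane : Prop where
  connected : ∀ x y : M.Vertex,
    Relation.ReflTransGen (fun a b => ∃ d, M.origin d = a ∧ M.target d = b) x y
  euler : Nat.card M.Vertex + Nat.card M.Face = Nat.card M.Edge + 2

/-- Turning clockwise around a vertex, starting from the arc `a` and before coming back to `a`,
one meets `b` and then `c` (weakly: `a = b` and `b = c` are allowed). -/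
def CwBetween (a b c : D) : Prop :=
  ∃ m n : ℕ, m ≤ n ∧ n < Function.minimalPeriod M.rot a ∧ (M.rot ^ m) a = b ∧ (M.rot ^ n) a = c

/-- `c` is a (simple, directed) cycle of length `k`. The last condition says that no edge is used
twice, which matters only for `k = 2`. -/
structure IsCycle (k : ℕ) [NeZero k] (c : ZMod k → D) : Prop where
  chain : ∀ j, M.target (c j) = M.origin (c (j + 1))
  simple : Function.Injective fun j => M.origin (c j)
  edges : ∀ j l, c j ≠ M.rev (c l)

/-- The vertex `x` is an end of an arc of `C`. -/
def OnArcs (C : Set D) (x : M.Vertex) : Prop :=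
  ∃ d ∈ C, M.origin d = x ∨ M.target d = x

/-- The faces `f` and `g` are on the two sides of an edge none of whose arcs is in `C`. -/
def DualStep (C : Set D) (f g : M.Face) : Prop :=
  ∃ d, d ∉ C ∧ M.rev d ∉ C ∧ M.leftFace d = f ∧ M.leftFace (M.rev d) = g

end CombMap

/-- A triangulation of the pentagon: a plane map with a distinguished (outer) face whose contour
is a simple cycle of length 5, all the other faces having degree 3. Indices in `[1:5]` are taken
modulo 5. The arc `outer i` goes from the outer vertex `v_i` to `v_{i+1}` and has the outer face on
its left, so that `v_1, ..., v_5` are in clockwise order along the contour. -/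
structure PentagonTriangulation (D : Type*) extends CombMap D where
  isPlane : toCombMap.IsPlane
  outer : ZMod 5 → D
  outer_next : ∀ i, toCombMap.facePerm (outer i) = outer (i + 1)
  outer_simple : Function.Injective fun i => toCombMap.origin (outer i)
  inner_degree : ∀ d, d ∉ Set.range outer → Function.minimalPeriod toCombMap.facePerm d = 3

namespace PentagonTriangulation

variable {D : Type*} (T : PentagonTriangulation D)

/-- The outer vertex `v_i`. -/
def outerVertex (i : ZMod 5) : T.Vertex := T.origin (T.outer i)

def IsOuterVertex (x : T.Vertex) : Prop := ∃ i, x = T.outerVertex i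

def outerFace : T.Face := T.leftFace (T.outer 0)

/-- Inner arcs: the arcs of the edges that are not on the outer contour. -/
def IsInnerArc (d : D) : Prop := d ∉ Set.range T.outer ∧ T.rev d ∉ Set.range T.outer

/-- For `C` the arcs of a simple cycle, the faces enclosed by it: those that cannot be reached from
the outer face without crossing the cycle. -/
def enclosedFaces (C : Set D) : Set T.Face :=
  {f | ¬ Relation.ReflTransGen (T.DualStep C) T.outerFace f}

/-- For `C` the arcs of a simple cycle, the vertices strictly inside it. -/
def interiorVertices (C : Set D) : Set T.Vertex :=
  {x | ¬ T.OnArcs C x ∧ ∃ d, T.origin d = x ∧ T.leftFace d ∈ T.enclosedFaces C}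

/-- 5c-triangulations: every cycle with at least one vertex in its interior has length at
least 5. -/
def IsFiveC : Prop :=
  ∀ (k : ℕ) [NeZero k] (c : ZMod k → D), T.IsCycle k c →
    (T.interiorVertices (Set.range c)).Nonempty → 5 ≤ k

/-- 5c-woods: tuples `W = (W_1, ..., W_5)` of disjoint sets of inner arcs satisfying
(W0)-(W3). An arc `d` with terminal vertex `x` is seen around `x` at the position of its opposite
arc `rev d`. -/
structure IsFiveCWood (W : ZMod 5 → Set D) : Prop where
  disjoint : ∀ i j, i ≠ j → Disjoint (W i) (W j)
  inner : ∀ i, ∀ d ∈ W i, T.IsInnerArc d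
  w0_start : ∀ i, ∀ d ∈ W i, ¬ T.IsOuterVertex (T.origin d)
  w0_end : ∀ i j, ∀ d ∈ W j, T.target d = T.outerVertex i → j = i
  w1_unique : ∀ x : T.Vertex, ¬ T.IsOuterVertex x → ∀ i, ∃! d, d ∈ W i ∧ T.origin d = x
  w1_order : ∀ (i : ZMod 5) (m n : ℕ), m ≤ n → n < 5 →
    ∀ a ∈ W i, ∀ b ∈ W (i + m), ∀ c ∈ W (i + n),
      T.origin a = T.origin b → T.origin a = T.origin c → T.CwBetween a b c
  w2 : ∀ i, ∀ d ∈ W i, ∀ b ∈ W (i + 2), ∀ c ∈ W (i + 3),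
    T.origin b = T.target d → T.origin c = T.target d → T.CwBetween b (T.rev d) c
  w3 : ∀ d, T.IsInnerArc d → ∃ i, d ∈ W i ∨ T.rev d ∈ W i

/-- The arcs of the directed path `P_i(x)` from `x` to `v_i` in `W_i`: the arcs met when one starts
at `x` and repeatedly follows the (unique) outgoing arc in `W_i`. -/
def pathArcs (W : ZMod 5 → Set D) (i : ZMod 5) (x : T.Vertex) : Set D :=
  {d | d ∈ W i ∧
    Relation.ReflTransGen (fun a b => ∃ e ∈ W i, T.origin e = a ∧ T.target e = b) x (T.origin d)}

/-- For an inner vertex `x`, the arcs of the cycle made of the outer edge `(v_{i+2}, v_{i-2})` and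
of the paths `P_{i-2}(x)` and `P_{i+2}(x)`. -/
def regionContour (W : ZMod 5 → Set D) (i : ZMod 5) (x : T.Vertex) : Set D :=
  {T.outer (i + 2)} ∪ T.pathArcs W (i - 2) x ∪ T.pathArcs W (i + 2) x

open Classical in
/-- The inner faces in the region `R_i(x)`. By convention, `R_i(v_i)` is the whole map and
`R_i(v_j) = {v_j}` for `j ≠ i`. -/
def regionFaces (W : ZMod 5 → Set D) (i : ZMod 5) (x : T.Vertex) : Set T.Face :=
  if x = T.outerVertex i then {f | f ≠ T.outerFace}
  else if T.IsOuterVertex x then ∅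
  else T.enclosedFaces (T.regionContour W i x)

open Classical in
/-- The vertices in the (closed) region `R_i(x)`. -/
def regionVertices (W : ZMod 5 → Set D) (i : ZMod 5) (x : T.Vertex) : Set T.Vertex :=
  if x = T.outerVertex i then Set.univ
  else if T.IsOuterVertex x then {x}
  else {y | T.OnArcs (T.regionContour W i x) y} ∪ T.interiorVertices (T.regionContour W i x)

/-- `α_i(x) = |R_i(x)| / (2n - 7)`, with `n` the number of vertices and `|R_i(x)|` the number of
inner faces in `R_i(x)`. -/
noncomputable def weight (W : ZMod 5 → Set D) (i : ZMod 5) (x : T.Vertex) : ℝ :=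
  ((T.regionFaces W i x).ncard : ℝ) / (2 * (Nat.card T.Vertex : ℝ) - 7)

/-- The position of the vertex `x` in the 5c-barycentric drawing with outer pentagon `p`. -/
noncomputable def drawing (W : ZMod 5 → Set D) (p : ZMod 5 → ℂ) (x : T.Vertex) : ℂ :=
  ∑ i, T.weight W i x • p i

end PentagonTriangulation

/-- In the plane `ℂ = ℝ²`, the points `p_1, ..., p_5` are, in clockwise order, the vertices of a
(nondegenerate) regular pentagon with center `c`. -/
def IsClockwiseRegularPentagon (p : ZMod 5 → ℂ) (c : ℂ) : Prop :=
  ∃ w : ℂ, w ≠ 0 ∧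
    ∀ k, p k = c + w * Complex.exp (-(2 * Real.pi * (k.val : ℝ) / 5 : ℝ) * Complex.I)

/-!
The regions are handled through winding functions. A chain is an antisymmetric function on the arcs;
in genus zero, Euler's relation implies that every chain without boundary is the jump, across the
arcs, of a function on the faces, its *winding function* (`CombMap.IsPlane.exists_winding`). For a
simple cycle the winding function takes two values, and it distinguishes the faces that the cycle
encloses from the others (`CombMap.IsSimpleCycle.reach_left_or_right`): this is the Jordan curve
theorem. In particular, the indicator function of the region `R_i(v)` is the winding function of its
contour (`IsFiveCWood.region_spec`), and adding up the five contours shows that the five regions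
partition the inner faces (`IsFiveCWood.sum_regionInd`).

All the geometry of 5c-woods comes from one local principle. A function `w` on the faces *traps* the
color `l` if, around each inner vertex, its maximum is attained next to the outgoing arc of color
`l`; a path of color `l` then cannot leave the closure of a set `{w ≥ c}`. When `w` is the winding
function of a chain made of paths of the wood, the axioms (W1) and (W2) give the cyclic order of the
arcs where `w` increases or decreases around the vertex, and `w` traps `l` as soon as this order is
"decreasing, then increasing", starting from the outgoing arc of color `l` (`IsFiveCWood.traps`).
This principle is applied four times.

* A directed cycle of color `i` traps inside it the color `i + 1` or the color `i - 1`, hence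
  encloses a smaller monochromatic directed cycle; so there is none (`IsFiveCWood.acyclic`), and
  every path `P_i(v)` ends at `v_i`.
* If two paths of consecutive colors from `v` met again, the winding function of the closed walk
  that they form, or its opposite, would trap a color (`IsFiveCWood.eq_of_iterate_eq`). So the
  contour of `R_i(v)` is a simple cycle.
* For `u` in `R_i(v)`, the paths `P_{i+2}(u)` and `P_{i-2}(u)` stay in `R_i(v)`. Hence `R_i(u)` is
  contained in `R_i(v)`, strictly if `u ≠ v` (`IsFiveCWood.regionFaces_ssubset`).
* For `u` in `R_i(v)`, the path `P_{i-1}(u)` stays in the union of `R_i(v)` and `R_{i+1}(v)`, and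
  `P_{i+1}(u)` in that of `R_i(v)` and `R_{i-1}(v)`. Hence they do not enter `R_{i+2}(v)` and
  `R_{i-2}(v)`, which are contained in the union of `R_{i+2}(u)` and `R_{i-2}(u)`
  (`IsFiveCWood.regionFaces_subset_union`).

Let `β_j` be the difference of the `j`-th barycentric coordinates of `u` and `v`. Then `β_i < 0`,
`β_{i+2} + β_{i-2} ≥ 0` and the `β_j` have sum zero, so that the inner product with `V_i` is a
positive multiple of
`β_i (1 - cos (2π/5)) - (β_{i+2} + β_{i-2}) (cos (2π/5) - cos (4π/5)) < 0`.
-/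

/-! ### Rotations, faces and connectedness -/

namespace CombMap

variable {D : Type*} (M : CombMap D)

theorem origin_eq_iff {a b : D} : M.origin a = M.origin b ↔ M.rot.SameCycle a b :=
  Quotient.eq (r := Equiv.Perm.SameCycle.setoid M.rot)

theorem leftFace_eq_iff {a b : D} : M.leftFace a = M.leftFace b ↔ M.facePerm.SameCycle a b :=
  Quotient.eq (r := Equiv.Perm.SameCycle.setoid M.facePerm)

theorem origin_rot (d : D) : M.origin (M.rot d) = M.origin d :=
  M.origin_eq_iff.2 (Equiv.Perm.SameCycle.refl _ _).apply_left

theorem origin_rot_pow (d : D) (n : ℕ) : M.origin ((M.rot ^ n) d) = M.origin d := by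
  induction n with
  | zero => rfl
  | succ n ih => rw [pow_succ', Equiv.Perm.mul_apply, origin_rot, ih]

/-- Turning clockwise by one arc around a vertex, one passes from the face on the left of `d`
to the face on its right, which is the face on the left of `rev d`. -/
theorem leftFace_rot (d : D) : M.leftFace (M.rot d) = M.leftFace (M.rev d) := by
  have h : M.facePerm (M.rev d) = M.rot d := by simp [facePerm, M.rev_rev]
  rw [← h, leftFace_eq_iff]
  exact (Equiv.Perm.SameCycle.refl _ _).apply_left

theorem target_rev (d : D) : M.target (M.rev d) = M.origin d := by
  rw [target, M.rev_rev]

theorem rev_injective : Function.Injective M.rev := M.rev.injective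

theorem rev_eq_iff {a b : D} : M.rev a = b ↔ a = M.rev b :=
  ⟨fun h => by rw [← h, M.rev_rev], fun h => by rw [h, M.rev_rev]⟩

theorem minimalPeriod_rot_pos (d : D) : 0 < Function.minimalPeriod M.rot d := by
  have := M.finite
  exact Function.minimalPeriod_pos_of_mem_periodicPts
    (M.rot.injective.mem_periodicPts d)

theorem rot_pow_eq_iterate (n : ℕ) (d : D) : (M.rot ^ n) d = M.rot^[n] d := by
  rw [Equiv.Perm.iterate_eq_pow]

theorem rot_pow_minimalPeriod (d : D) :
    (M.rot ^ Function.minimalPeriod M.rot d) d = d := by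
  rw [rot_pow_eq_iterate]
  exact Function.isPeriodicPt_minimalPeriod _ _

theorem exists_rot_pow {a b : D} (h : M.origin a = M.origin b) :
    ∃ n < Function.minimalPeriod M.rot a, (M.rot ^ n) a = b := by
  have := M.finite
  obtain ⟨n, hn⟩ := (M.origin_eq_iff.1 h).exists_nat_pow_eq
  refine ⟨n % Function.minimalPeriod M.rot a, Nat.mod_lt _ (M.minimalPeriod_rot_pos a), ?_⟩
  rw [rot_pow_eq_iterate, Function.iterate_mod_minimalPeriod_eq, ← rot_pow_eq_iterate, hn]

theorem rot_pow_inj {a : D} {m n : ℕ} (hm : m < Function.minimalPeriod M.rot a)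
    (hn : n < Function.minimalPeriod M.rot a) (h : (M.rot ^ m) a = (M.rot ^ n) a) : m = n := by
  rw [rot_pow_eq_iterate, rot_pow_eq_iterate] at h
  exact (Function.iterate_eq_iterate_iff_of_lt_minimalPeriod hm hn).1 h

theorem rot_pow_inj_mod {a : D} {m n : ℕ} (h : (M.rot ^ m) a = (M.rot ^ n) a) :
    m ≡ n [MOD Function.minimalPeriod M.rot a] := by
  have hp := M.minimalPeriod_rot_pos a
  refine M.rot_pow_inj (Nat.mod_lt m hp) (Nat.mod_lt n hp) ?_
  simpa only [rot_pow_eq_iterate, Function.iterate_mod_minimalPeriod_eq] using h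

variable {M}

theorem IsPlane.arc_induction (hM : M.IsPlane) (p : D → Prop)
    (hrot : ∀ d, p d → p (M.rot d)) (hrev : ∀ d, p d → p (M.rev d)) {a : D} (ha : p a) (b : D) :
    p b := by
  have hsame : ∀ {x y : D}, M.origin x = M.origin y → p x → p y := by
    intro x y h hx
    obtain ⟨n, -, rfl⟩ := M.exists_rot_pow h
    clear h
    induction n with
    | zero => exact hx
    | succ n ih => rw [pow_succ']; exact hrot _ ih
  have key : ∀ y, Relation.ReflTransGen (fun a b => ∃ d, M.origin d = a ∧ M.target d = b)
      (M.origin a) y → ∀ d, M.origin d = y → p d := by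
    intro y hy
    induction hy with
    | refl => exact fun d hd => hsame hd.symm ha
    | tail _ h ih =>
      rintro d rfl
      obtain ⟨e, he, he'⟩ := h
      exact hsame he' (hrev _ (ih e he))
  exact key _ (hM.connected _ _) b rfl

theorem IsPlane.vertex_induction (hM : M.IsPlane) (p : M.Vertex → Prop)
    (h : ∀ d, p (M.origin d) → p (M.target d)) {x : M.Vertex} (hx : p x) (y : M.Vertex) : p y := by
  induction hM.connected x y with
  | refl => exact hx
  | tail _ h' ih =>
    obtain ⟨d, rfl, rfl⟩ := h'
    exact h d ih

/-- The dual graph of a connected map is connected. -/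
theorem IsPlane.face_induction (hM : M.IsPlane) (p : M.Face → Prop)
    (h : ∀ d, p (M.leftFace d) → p (M.leftFace (M.rev d))) {f : M.Face} (hf : p f) (g : M.Face) :
    p g := by
  obtain ⟨a, rfl⟩ := Quotient.exists_rep f
  obtain ⟨b, rfl⟩ := Quotient.exists_rep g
  refine hM.arc_induction (fun d => p (M.leftFace d)) (fun d hd => ?_) h hf b
  rw [leftFace_rot]
  exact h d hd

variable (M)

theorem dualStep_symm (C : Set D) {f g : M.Face} (h : M.DualStep C f g) : M.DualStep C g f := by
  obtain ⟨d, h1, h2, rfl, rfl⟩ := h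
  exact ⟨M.rev d, h2, by rwa [M.rev_rev], rfl, by rw [M.rev_rev]⟩

theorem dualReach_symm (C : Set D) {f g : M.Face}
    (h : Relation.ReflTransGen (M.DualStep C) f g) : Relation.ReflTransGen (M.DualStep C) g f :=
  have : Std.Symm (M.DualStep C) := ⟨fun _ _ => M.dualStep_symm C⟩
  Std.Symm.symm _ _ h

/-! ### Winding functions of closed chains -/

/-- A function on the faces is a winding function of the chain `φ` if its jump across each arc `d`,
from the left to the right of `d`, is `φ d`. -/
def IsWinding (φ : D → ℝ) (w : M.Face → ℝ) : Prop :=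
  ∀ d, w (M.leftFace (M.rev d)) = w (M.leftFace d) + φ d

/-- The boundary of the chain `φ`, evaluated on a function `g` on the vertices. -/
noncomputable def boundary [Fintype D] (φ : D → ℝ) (g : M.Vertex → ℝ) : ℝ :=
  ∑ d, φ d * g (M.origin d)

variable {M}

theorem IsWinding.eq_of_eq_at (hM : M.IsPlane) {φ : D → ℝ} {w w' : M.Face → ℝ}
    (h : M.IsWinding φ w) (h' : M.IsWinding φ w') {f : M.Face} (hf : w f = w' f) (g : M.Face) :
    w g = w' g :=
  hM.face_induction (fun g => w g = w' g) (fun d hd => by rw [h d, h' d, hd]) hf g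

theorem IsWinding.rot {φ : D → ℝ} {w : M.Face → ℝ} (h : M.IsWinding φ w) (d : D) :
    w (M.leftFace (M.rot d)) = w (M.leftFace d) + φ d := by
  rw [leftFace_rot, h]

theorem IsWinding.neg {φ : D → ℝ} {w : M.Face → ℝ} (h : M.IsWinding φ w) :
    M.IsWinding (-φ) (-w) := fun d => by
  simp only [Pi.neg_apply, h d]; ring

theorem IsWinding.add {φ ψ : D → ℝ} {w z : M.Face → ℝ} (h : M.IsWinding φ w)
    (h' : M.IsWinding ψ z) : M.IsWinding (φ + ψ) (w + z) := fun d => by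
  simp only [Pi.add_apply, h d, h' d]; ring

theorem IsWinding.sum {ι : Type*} (s : Finset ι) {φ : ι → D → ℝ} {w : ι → M.Face → ℝ}
    (h : ∀ i ∈ s, M.IsWinding (φ i) (w i)) :
    M.IsWinding (∑ i ∈ s, φ i) (∑ i ∈ s, w i) := fun d => by
  simp only [Finset.sum_apply, ← Finset.sum_add_distrib]
  exact Finset.sum_congr rfl fun i hi => h i hi d

/-- Around a vertex that the chain avoids, a winding function is constant. -/
theorem IsWinding.const_around {φ : D → ℝ} {w : M.Face → ℝ} (h : M.IsWinding φ w)
    {a b : D} (hab : M.origin a = M.origin b) (h0 : ∀ d, M.origin d = M.origin a → φ d = 0) :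
    w (M.leftFace b) = w (M.leftFace a) := by
  obtain ⟨n, -, rfl⟩ := M.exists_rot_pow hab
  clear hab
  induction n with
  | zero => rfl
  | succ n ih =>
    rw [pow_succ', Equiv.Perm.mul_apply, h.rot, h0 _ (M.origin_rot_pow a n), ih, add_zero]

variable (M)

theorem card_le_two_mul_card_edge : Nat.card D ≤ 2 * Nat.card M.Edge := by
  classical
  have := M.finite
  have : Finite M.Edge := Quotient.finite _
  have := Fintype.ofFinite D
  have := Fintype.ofFinite M.Edge
  rw [Nat.card_eq_fintype_card, Nat.card_eq_fintype_card]
  let q : D → M.Edge := Quotient.mk (Equiv.Perm.SameCycle.setoid M.rev)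
  have h := Finset.card_le_mul_card_image (f := q) (Finset.univ : Finset D) 2 (by
    intro e _
    obtain ⟨a, rfl⟩ := Quotient.exists_rep e
    refine (Finset.card_le_card (t := {a, M.rev a}) ?_).trans Finset.card_le_two
    intro b hb
    simp only [Finset.mem_filter, Finset.mem_univ, true_and] at hb
    have hb : M.rev.SameCycle b a :=
      (Quotient.eq (r := Equiv.Perm.SameCycle.setoid M.rev)).1 hb
    obtain ⟨n, hn⟩ := hb.symm.exists_nat_pow_eq
    have key : ∀ n : ℕ, (M.rev ^ n) a = a ∨ (M.rev ^ n) a = M.rev a := by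
      intro n
      induction n with
      | zero => left; rfl
      | succ n ih =>
        rw [pow_succ', Equiv.Perm.mul_apply]
        rcases ih with ih | ih <;> rw [ih]
        · right; rfl
        · left; exact M.rev_rev a
    rw [Finset.mem_insert, Finset.mem_singleton, ← hn]
    exact key n)
  calc Fintype.card D ≤ 2 * (Finset.univ.image q).card := h
    _ ≤ 2 * Fintype.card M.Edge := Nat.mul_le_mul_left _ (Finset.card_le_univ _)

variable {M}

/-- In genus zero, every closed chain has a winding function: by Euler's relation, the dimension of
the space of coboundaries of functions on the faces is that of the orthogonal complement of the
coboundaries of functions on the vertices, among the antisymmetric functions on the arcs. -/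
theorem IsPlane.exists_winding [Fintype D] (hM : M.IsPlane) {φ : D → ℝ}
    (hanti : ∀ d, φ (M.rev d) = -φ d) (hclosed : ∀ g, M.boundary φ g = 0) (f₀ : M.Face) :
    ∃ w, M.IsWinding φ w ∧ w f₀ = 0 := by
  classical
  have : Finite M.Edge := Quotient.finite _
  have : Finite M.Face := Quotient.finite _
  have : Finite M.Vertex := Quotient.finite _
  have := Fintype.ofFinite M.Edge
  have := Fintype.ofFinite M.Face
  have := Fintype.ofFinite M.Vertex
  obtain ⟨a₀, -⟩ := Quotient.exists_rep f₀
  let q : D → M.Edge := Quotient.mk (Equiv.Perm.SameCycle.setoid M.rev)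
  have hq : ∀ d, q (M.rev d) = q d := fun d =>
    (Quotient.eq (r := Equiv.Perm.SameCycle.setoid M.rev)).2
      (Equiv.Perm.SameCycle.refl _ _).apply_left
  let L := (WithLp.linearEquiv 2 ℝ (D → ℝ)).symm
  let A₀ : ((M.Vertex → ℝ) × (M.Edge → ℝ)) →ₗ[ℝ] (D → ℝ) :=
    { toFun := fun p d => p.1 (M.origin d) - p.1 (M.target d) + p.2 (q d)
      map_add' := fun x y => by
        funext d; simp only [Prod.fst_add, Prod.snd_add, Pi.add_apply]; ring
      map_smul' := fun c x => by
        funext d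
        simp only [Prod.smul_fst, Prod.smul_snd, Pi.smul_apply, smul_eq_mul, RingHom.id_apply]
        ring }
  let B₀ : (M.Face → ℝ) →ₗ[ℝ] (D → ℝ) :=
    { toFun := fun w d => w (M.leftFace (M.rev d)) - w (M.leftFace d)
      map_add' := fun x y => by funext d; simp only [Pi.add_apply]; ring
      map_smul' := fun c x => by
        funext d; simp only [Pi.smul_apply, smul_eq_mul, RingHom.id_apply]; ring }
  let A := L.toLinearMap ∘ₗ A₀
  let B := L.toLinearMap ∘ₗ B₀
  have inner_eq : ∀ x y : D → ℝ, inner ℝ (L x) (L y) = ∑ d, x d * y d := by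
    intro x y
    simp [L, PiLp.inner_apply, mul_comm]
  -- antisymmetric closed chains are orthogonal to the range of `A`
  have horth : ∀ ψ : D → ℝ, (∀ d, ψ (M.rev d) = -ψ d) → (∀ g, M.boundary ψ g = 0) →
      L ψ ∈ (LinearMap.range A)ᗮ := by
    intro ψ h1 h2
    rw [Submodule.mem_orthogonal]
    rintro _ ⟨⟨g, h⟩, rfl⟩
    have e1 : ∀ k : D → ℝ, ∑ d, k (M.rev d) * ψ (M.rev d) = ∑ d, k d * ψ d := fun k =>
      Equiv.sum_comp M.rev (fun d => k d * ψ d)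
    change inner ℝ (L (A₀ (g, h))) (L ψ) = 0
    rw [inner_eq]
    have e2 : ∑ d, h (q d) * ψ d = 0 := by
      have := e1 (fun d => h (q d))
      simp only [hq, h1, mul_neg, Finset.sum_neg_distrib] at this
      linarith
    have e3 : ∑ d, g (M.origin d) * ψ d = 0 := by
      rw [← h2 g]; exact Finset.sum_congr rfl fun d _ => mul_comm _ _
    have e4 : ∑ d, g (M.target d) * ψ d = 0 := by
      have := e1 (fun d => g (M.origin d))
      simp only [h1, mul_neg, Finset.sum_neg_distrib] at this
      have h5 : ∑ d, g (M.target d) * ψ d = ∑ d, g (M.origin (M.rev d)) * ψ d := rfl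
      linarith
    change ∑ d, (g (M.origin d) - g (M.target d) + h (q d)) * ψ d = 0
    simp only [add_mul, sub_mul, Finset.sum_add_distrib, Finset.sum_sub_distrib, e2, e3, e4]
    simp
  have hkerA : Module.finrank ℝ (LinearMap.ker A) ≤ 1 := by
    refine finrank_le_one ⟨((fun _ => 1), 0), ?_⟩ ?_
    · rw [LinearMap.mem_ker]
      change L (A₀ _) = 0
      rw [map_eq_zero_iff L L.injective]
      funext d
      simp [A₀]
    · rintro ⟨⟨g, h⟩, hgh⟩
      have hgh : A₀ (g, h) = 0 := by
        rw [LinearMap.mem_ker] at hgh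
        exact (map_eq_zero_iff L L.injective).1 hgh
      have e : ∀ d, g (M.origin d) - g (M.target d) + h (q d) = 0 := fun d => congrFun hgh d
      have e' : ∀ d, g (M.target d) - g (M.origin d) + h (q d) = 0 := fun d => by
        have := e (M.rev d)
        rwa [target_rev, hq] at this
      refine ⟨g (M.origin a₀), Subtype.ext (Prod.ext ?_ ?_)⟩
      · funext x
        have : g x = g (M.origin a₀) := hM.vertex_induction (fun x => g x = g (M.origin a₀))
          (fun d hd => by linarith [e d, e' d]) rfl x
        simp [this]
      · funext x
        obtain ⟨d, rfl⟩ := Quotient.exists_rep x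
        have : h (q d) = 0 := by linarith [e d, e' d]
        change g (M.origin a₀) * 0 = h (q d)
        rw [this, mul_zero]
  have hkerB : Module.finrank ℝ (LinearMap.ker B) ≤ 1 := by
    refine finrank_le_one ⟨(fun _ => 1), ?_⟩ ?_
    · rw [LinearMap.mem_ker]
      change L (B₀ _) = 0
      rw [map_eq_zero_iff L L.injective]
      funext d
      simp [B₀]
    · rintro ⟨w, hw⟩
      have hw : B₀ w = 0 := by
        rw [LinearMap.mem_ker] at hw
        exact (map_eq_zero_iff L L.injective).1 hw
      have e : ∀ d, w (M.leftFace (M.rev d)) - w (M.leftFace d) = 0 := fun d => congrFun hw d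
      refine ⟨w f₀, Subtype.ext ?_⟩
      funext f
      have : w f = w f₀ := hM.face_induction (fun f => w f = w f₀)
        (fun d hd => by linarith [e d]) rfl f
      simp [this]
  have hBA : LinearMap.range B ≤ (LinearMap.range A)ᗮ := by
    rintro _ ⟨w, rfl⟩
    refine horth (B₀ w) (fun d => ?_) (fun g => ?_)
    · change w (M.leftFace (M.rev (M.rev d))) - w (M.leftFace (M.rev d)) =
        -(w (M.leftFace (M.rev d)) - w (M.leftFace d))
      rw [M.rev_rev]; ring
    · -- the sum telescopes around each vertex
      change ∑ d, (w (M.leftFace (M.rev d)) - w (M.leftFace d)) * g (M.origin d) = 0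
      have := Equiv.sum_comp M.rot (fun d => w (M.leftFace d) * g (M.origin d))
      simp only [leftFace_rot, origin_rot] at this
      simp only [sub_mul, Finset.sum_sub_distrib, this, sub_self]
  have hle : Module.finrank ℝ ↥(LinearMap.range A)ᗮ ≤ Module.finrank ℝ (LinearMap.range B) := by
    have h1 := Submodule.finrank_add_finrank_orthogonal (LinearMap.range A)
    have h2 := LinearMap.finrank_range_add_finrank_ker A
    have h3 := LinearMap.finrank_range_add_finrank_ker B
    have h4 := M.card_le_two_mul_card_edge
    have h5 := hM.euler
    rw [Nat.card_eq_fintype_card, Nat.card_eq_fintype_card] at h4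
    simp only [Nat.card_eq_fintype_card] at h5
    rw [finrank_euclideanSpace] at h1
    rw [Module.finrank_prod, Module.finrank_fintype_fun_eq_card,
      Module.finrank_fintype_fun_eq_card] at h2
    rw [Module.finrank_fintype_fun_eq_card] at h3
    omega
  have heq := Submodule.eq_of_le_of_finrank_le hBA hle
  obtain ⟨w, hw⟩ : L φ ∈ LinearMap.range B := heq ▸ horth φ hanti hclosed
  have hw : B₀ w = φ := L.injective hw
  refine ⟨fun f => w f - w f₀, fun d => ?_, sub_self _⟩
  have : w (M.leftFace (M.rev d)) - w (M.leftFace d) = φ d := congrFun hw d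
  simp only
  linarith

end CombMap

/-! ### Simple cycles and the Jordan curve theorem -/

namespace CombMap

variable {D : Type*} (M : CombMap D)

/-- The chain of a set of arcs: its arcs with coefficient `1`, their opposites with `-1`. -/
noncomputable def chain (C : Set D) (d : D) : ℝ :=
  C.indicator 1 d - C.indicator 1 (M.rev d)

theorem chain_rev (C : Set D) (d : D) : M.chain C (M.rev d) = -M.chain C d := by
  rw [chain, chain, M.rev_rev]; ring

theorem chain_of_notMem {C : Set D} {d : D} (h : d ∉ C) (h' : M.rev d ∉ C) :
    M.chain C d = 0 := by
  simp [chain, h, h']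

theorem chain_of_mem {C : Set D} {d : D} (h : d ∈ C) (h' : M.rev d ∉ C) :
    M.chain C d = 1 := by
  simp [chain, h, h']

theorem indicator_one_nonneg (C : Set D) (d : D) : (0 : ℝ) ≤ C.indicator 1 d :=
  Set.indicator_nonneg (fun _ _ => zero_le_one) d

theorem chain_le_zero {C : Set D} {d : D} (h : d ∉ C) : M.chain C d ≤ 0 := by
  rw [chain, Set.indicator_of_notMem h, zero_sub]
  exact neg_nonpos.2 (indicator_one_nonneg C _)

theorem chain_nonneg {C : Set D} {d : D} (h : M.rev d ∉ C) : 0 ≤ M.chain C d := by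
  rw [chain, Set.indicator_of_notMem h, sub_zero]
  exact indicator_one_nonneg C _

/-- The boundary of a set of arcs, evaluated on `g`, sums the differences of `g` between the
initial and the terminal vertices. -/
theorem boundary_chain [Fintype D] (C : Set D) (g : M.Vertex → ℝ) :
    M.boundary (M.chain C) g =
      ∑ d, C.indicator 1 d * (g (M.origin d) - g (M.target d)) := by
  have h := Equiv.sum_comp M.rev (fun d => C.indicator (1 : D → ℝ) d * g (M.target d))
  simp only [target_rev] at h
  simp only [boundary, chain, sub_mul, mul_sub, Finset.sum_sub_distrib, h]

/-- `C` is the set of arcs of a directed simple cycle. The last field says that `C` is a single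
cycle: a property that passes from an arc to the next and to the previous one holds everywhere on
`C` if it holds somewhere on `C`. -/
structure IsSimpleCycle (C : Set D) : Prop where
  out_unique : ∀ a ∈ C, ∀ b ∈ C, M.origin a = M.origin b → a = b
  in_unique : ∀ a ∈ C, ∀ b ∈ C, M.target a = M.target b → a = b
  rev_notMem : ∀ a ∈ C, M.rev a ∉ C
  conn : ∀ p : D → Prop, (∀ a ∈ C, ∀ b ∈ C, M.target a = M.origin b → (p a ↔ p b)) →
    ∀ a ∈ C, ∀ b ∈ C, p a → p b

variable {M}

/-- If the cycle `C` meets a vertex in the arcs `a` and `b` only, then the clockwise sector from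
`a` to `b` is not cut by `C`. -/
theorem reach_sector {C : Set D} {a b : D} (hab : M.origin a = M.origin b) (hne : a ≠ b)
    (h : ∀ d, M.origin d = M.origin a → d ∈ C ∨ M.rev d ∈ C → d = a ∨ d = b) :
    Relation.ReflTransGen (M.DualStep C) (M.leftFace (M.rev a)) (M.leftFace b) := by
  obtain ⟨n, hn, rfl⟩ := M.exists_rot_pow hab
  have key : ∀ k, k + 1 ≤ n → Relation.ReflTransGen (M.DualStep C) (M.leftFace (M.rev a))
      (M.leftFace ((M.rot ^ (k + 1)) a)) := by
    intro k hk
    induction k with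
    | zero => rw [zero_add, pow_one, leftFace_rot]
    | succ k ih =>
      refine (ih (by omega)).tail ?_
      rw [pow_succ' _ (k + 1), Equiv.Perm.mul_apply, leftFace_rot]
      have hd : ¬((M.rot ^ (k + 1)) a ∈ C ∨ M.rev ((M.rot ^ (k + 1)) a) ∈ C) := by
        intro hc
        rcases h _ (M.origin_rot_pow _ _) hc with h0 | h0
        · have := M.rot_pow_inj (m := k + 1) (n := 0) (by omega) (by omega) h0
          omega
        · have := M.rot_pow_inj (by omega) hn h0
          omega
      rw [not_or] at hd
      exact ⟨_, hd.1, hd.2, rfl, rfl⟩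
  cases n with
  | zero => exact absurd rfl hne
  | succ n => exact key n le_rfl

theorem IsSimpleCycle.eq_or_eq {C : Set D} (hC : M.IsSimpleCycle C) {a b : D} (ha : a ∈ C)
    (hb : b ∈ C) (hab : M.target a = M.origin b) {d : D} (hd : M.origin d = M.origin b)
    (h : d ∈ C ∨ M.rev d ∈ C) : d = b ∨ d = M.rev a := by
  rcases h with h | h
  · exact Or.inl (hC.out_unique _ h _ hb hd)
  · right
    rw [← M.rev_eq_iff]
    exact hC.in_unique _ h _ ha (by rw [target_rev, hd, hab])

theorem IsSimpleCycle.reach_next {C : Set D} (hC : M.IsSimpleCycle C) {a b : D} (ha : a ∈ C)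
    (hb : b ∈ C) (hab : M.target a = M.origin b) :
    Relation.ReflTransGen (M.DualStep C) (M.leftFace a) (M.leftFace b) ∧
      Relation.ReflTransGen (M.DualStep C) (M.leftFace (M.rev b)) (M.leftFace (M.rev a)) := by
  have hne : b ≠ M.rev a := fun h => hC.rev_notMem a ha (h ▸ hb)
  have hor : M.origin (M.rev a) = M.origin b := hab
  constructor
  · have := reach_sector (C := C) hor hne.symm (fun d hd h =>
      (hC.eq_or_eq ha hb hab (hd.trans hor) h).symm)
    rwa [M.rev_rev] at this
  · exact reach_sector (C := C) hor.symm hne (fun d hd h => hC.eq_or_eq ha hb hab hd h)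

/-- Each side of a simple cycle is connected: every face can be reached, without crossing the
cycle, from the left or from the right of any given arc of the cycle. -/
theorem IsSimpleCycle.reach_left_or_right (hM : M.IsPlane) {C : Set D} (hC : M.IsSimpleCycle C)
    {c : D} (hc : c ∈ C) (f : M.Face) :
    Relation.ReflTransGen (M.DualStep C) (M.leftFace c) f ∨
      Relation.ReflTransGen (M.DualStep C) (M.leftFace (M.rev c)) f := by
  have hleft : ∀ a ∈ C, Relation.ReflTransGen (M.DualStep C) (M.leftFace c) (M.leftFace a) :=
    fun a ha => hC.conn
      (fun a => Relation.ReflTransGen (M.DualStep C) (M.leftFace c) (M.leftFace a))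
      (fun a ha b hb hab => ⟨fun h => h.trans (hC.reach_next ha hb hab).1,
        fun h => h.trans (M.dualReach_symm C (hC.reach_next ha hb hab).1)⟩) c hc a ha .refl
  have hright : ∀ a ∈ C, Relation.ReflTransGen (M.DualStep C) (M.leftFace (M.rev c))
      (M.leftFace (M.rev a)) :=
    fun a ha => hC.conn
      (fun a => Relation.ReflTransGen (M.DualStep C) (M.leftFace (M.rev c))
        (M.leftFace (M.rev a)))
      (fun a ha b hb hab => ⟨fun h => h.trans (M.dualReach_symm C (hC.reach_next ha hb hab).2),
        fun h => h.trans (hC.reach_next ha hb hab).2⟩) c hc a ha .refl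
  refine hM.face_induction (fun f => Relation.ReflTransGen (M.DualStep C) (M.leftFace c) f ∨
      Relation.ReflTransGen (M.DualStep C) (M.leftFace (M.rev c)) f) (fun d hd => ?_)
      (Or.inl .refl) f
  by_cases h1 : d ∈ C
  · exact Or.inr (hright d h1)
  by_cases h2 : M.rev d ∈ C
  · exact Or.inl (hleft _ h2)
  exact hd.imp (fun h => h.tail ⟨d, h1, h2, rfl, rfl⟩) (fun h => h.tail ⟨d, h1, h2, rfl, rfl⟩)

theorem IsSimpleCycle.boundary_chain_eq_zero [Fintype D] {C : Set D} (hC : M.IsSimpleCycle C)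
    (hsucc : ∀ a ∈ C, ∃ b ∈ C, M.origin b = M.target a) (g : M.Vertex → ℝ) :
    M.boundary (M.chain C) g = 0 := by
  classical
  choose! σ hσ hσ' using hsucc
  have hmaps : Set.MapsTo σ C C := fun a ha => hσ a ha
  have hinj : Set.InjOn σ C := fun a ha b hb hab =>
    hC.in_unique a ha b hb (by rw [← hσ' a ha, ← hσ' b hb, hab])
  have hsurj : Set.SurjOn σ C C :=
    hmaps.restrict_surjective_iff.1
      (Finite.surjective_of_injective (hmaps.restrict_inj.2 hinj))
  rw [boundary_chain]
  simp only [mul_sub, Finset.sum_sub_distrib, Set.indicator_apply, Pi.one_apply, ite_mul, one_mul,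
    zero_mul, ← Finset.sum_filter]
  rw [sub_eq_zero]
  symm
  refine Finset.sum_bij (fun a _ => σ a) ?_ ?_ ?_ ?_
  · intro a ha
    simp only [Finset.mem_filter, Finset.mem_univ, true_and] at ha ⊢
    exact hmaps ha
  · intro a ha b hb hab
    simp only [Finset.mem_filter, Finset.mem_univ, true_and] at ha hb
    exact hinj ha hb hab
  · intro b hb
    simp only [Finset.mem_filter, Finset.mem_univ, true_and] at hb
    obtain ⟨a, ha, rfl⟩ := hsurj hb
    exact ⟨a, by simpa using ha, rfl⟩
  · intro a ha
    simp only [Finset.mem_filter, Finset.mem_univ, true_and] at ha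
    rw [hσ' a ha]

theorem IsWinding.eq_of_reach {φ : D → ℝ} {w : M.Face → ℝ} (h : M.IsWinding φ w) {C : Set D}
    (hC : ∀ d, d ∉ C → M.rev d ∉ C → φ d = 0) {f g : M.Face}
    (hfg : Relation.ReflTransGen (M.DualStep C) f g) : w g = w f := by
  induction hfg with
  | refl => rfl
  | tail _ hs ih =>
    obtain ⟨d, h1, h2, rfl, rfl⟩ := hs
    rw [h d, hC d h1 h2, add_zero, ih]

/-- The winding function of a simple cycle separates the two sides of the cycle. -/
theorem IsSimpleCycle.reach_of_winding_eq (hM : M.IsPlane) {C : Set D} (hC : M.IsSimpleCycle C)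
    {c : D} (hc : c ∈ C) {w : M.Face → ℝ} (hw : M.IsWinding (M.chain C) w) {f g : M.Face}
    (hfg : w f = w g) : Relation.ReflTransGen (M.DualStep C) f g := by
  have hz : ∀ d, d ∉ C → M.rev d ∉ C → M.chain C d = 0 := fun d => M.chain_of_notMem
  have hjump := hw c
  rw [M.chain_of_mem hc (hC.rev_notMem c hc)] at hjump
  rcases hC.reach_left_or_right hM hc f with h1 | h1 <;>
  rcases hC.reach_left_or_right hM hc g with h2 | h2
  · exact (M.dualReach_symm C h1).trans h2
  · have := hw.eq_of_reach hz h1; have := hw.eq_of_reach hz h2; linarith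
  · have := hw.eq_of_reach hz h1; have := hw.eq_of_reach hz h2; linarith
  · exact (M.dualReach_symm C h1).trans h2

theorem IsSimpleCycle.winding_eq_or (hM : M.IsPlane) {C : Set D} (hC : M.IsSimpleCycle C)
    {c : D} (hc : c ∈ C) {w : M.Face → ℝ} (hw : M.IsWinding (M.chain C) w) (f : M.Face) :
    w f = w (M.leftFace c) ∨ w f = w (M.leftFace c) + 1 := by
  have hz : ∀ d, d ∉ C → M.rev d ∉ C → M.chain C d = 0 := fun d => M.chain_of_notMem
  have hjump := hw c
  rw [M.chain_of_mem hc (hC.rev_notMem c hc)] at hjump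
  rw [← hjump]
  exact (hC.reach_left_or_right hM hc f).imp (hw.eq_of_reach hz) (hw.eq_of_reach hz)

end CombMap

/-! ### The outer contour -/

namespace PentagonTriangulation

variable {D : Type*} (T : PentagonTriangulation D)

theorem target_outer (i : ZMod 5) : T.target (T.outer i) = T.outerVertex (i + 1) := by
  have h : T.rot (T.rev (T.outer i)) = T.outer (i + 1) := T.outer_next i
  rw [outerVertex, ← h, CombMap.origin_rot]
  rfl

theorem outerVertex_injective : Function.Injective T.outerVertex := T.outer_simple

theorem rev_outer_ne (i j : ZMod 5) : T.rev (T.outer i) ≠ T.outer j := by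
  intro h
  have h1 : T.outerVertex (i + 1) = T.outerVertex j := by
    rw [← target_outer, CombMap.target, h]; rfl
  have h2 : T.outerVertex i = T.outerVertex (j + 1) := by
    rw [← target_outer, ← h, CombMap.target_rev]; rfl
  have h1 := T.outerVertex_injective h1
  have h2 := T.outerVertex_injective h2
  rw [← h1, add_assoc] at h2
  exact absurd (left_eq_add.1 h2) (by decide)

theorem leftFace_eq_outerFace_iff (d : D) :
    T.leftFace d = T.outerFace ↔ d ∈ Set.range T.outer := by
  have hpow : ∀ n : ℕ, (T.facePerm ^ n) (T.outer 0) = T.outer n := by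
    intro n
    induction n with
    | zero => simp
    | succ n ih => rw [pow_succ', Equiv.Perm.mul_apply, ih, T.outer_next]; push_cast; rfl
  rw [outerFace, eq_comm, CombMap.leftFace_eq_iff]
  constructor
  · intro h
    have := T.finite
    obtain ⟨n, hn⟩ := h.exists_nat_pow_eq
    exact ⟨n, by rw [← hn, hpow]⟩
  · rintro ⟨i, rfl⟩
    exact ⟨i.val, by rw [zpow_natCast, hpow, ZMod.natCast_zmod_val]⟩

theorem leftFace_outer (i : ZMod 5) : T.leftFace (T.outer i) = T.outerFace :=
  (T.leftFace_eq_outerFace_iff _).2 ⟨i, rfl⟩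

theorem leftFace_rev_outer_ne (i : ZMod 5) : T.leftFace (T.rev (T.outer i)) ≠ T.outerFace := by
  rw [Ne, leftFace_eq_outerFace_iff]
  rintro ⟨j, hj⟩
  exact T.rev_outer_ne i j hj.symm

theorem isOuterVertex_outerVertex (i : ZMod 5) : T.IsOuterVertex (T.outerVertex i) := ⟨i, rfl⟩

variable {T}

theorem winding_at_outer {φ : D → ℝ} {w : T.Face → ℝ} (hw : T.IsWinding φ w)
    (h0 : w T.outerFace = 0) {d : D} {k : ZMod 5} (hd : T.origin d = T.outerVertex k)
    (h : ∀ e, T.origin e = T.outerVertex k → φ e = 0) : w (T.leftFace d) = 0 := by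
  rw [hw.const_around (a := T.outer k) hd.symm h, leftFace_outer, h0]

/-! ### Colored arcs around an inner vertex -/

open Classical in
/-- The outgoing arc of color `i` at the inner vertex `x` (a junk value if there is none). -/
noncomputable def out (W : ZMod 5 → Set D) (i : ZMod 5) (x : T.Vertex) : D :=
  if h : ∃ d ∈ W i, T.origin d = x then h.choose else T.outer 0

namespace IsFiveCWood

variable {W : ZMod 5 → Set D} (hW : T.IsFiveCWood W)

include hW

theorem out_spec (i : ZMod 5) {x : T.Vertex} (hx : ¬T.IsOuterVertex x) :
    out W i x ∈ W i ∧ T.origin (out W i x) = x := by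
  have h : ∃ d ∈ W i, T.origin d = x := (hW.w1_unique x hx i).exists
  rw [out, dif_pos h]
  exact h.choose_spec

theorem eq_of_origin {i : ZMod 5} {d e : D} (hd : d ∈ W i) (he : e ∈ W i)
    (h : T.origin d = T.origin e) : d = e :=
  (hW.w1_unique (T.origin e) (hW.w0_start i e he) i).unique ⟨hd, h⟩ ⟨he, rfl⟩

theorem out_origin {i : ZMod 5} {d : D} (hd : d ∈ W i) : out W i (T.origin d) = d :=
  hW.eq_of_origin (hW.out_spec i (hW.w0_start i d hd)).1 hd
    (hW.out_spec i (hW.w0_start i d hd)).2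

theorem color_unique {i j : ZMod 5} {d : D} (hi : d ∈ W i) (hj : d ∈ W j) : i = j := by
  by_contra h
  exact Set.disjoint_left.1 (hW.disjoint i j h) hi hj

/-- Positions of the colored arcs around an inner vertex `y`, counted clockwise from the outgoing
arc of color `l`: the outgoing arc of color `l + m` is at position `p m`, and an arc of color
`l + m + 3` ending at `y` is seen between the positions `p m` and `p (m + 1)`. -/
theorem exists_positions (l : ZMod 5) {y : T.Vertex} (hy : ¬T.IsOuterVertex y) :
    ∃ p : ℕ → ℕ, p 0 = 0 ∧ p 5 = Function.minimalPeriod T.rot (out W l y) ∧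
      (∀ m : ℕ, m < 5 → p m < p (m + 1)) ∧
      (∀ m : ℕ, m ≤ 5 → (T.rot ^ p m) (out W l y) = out W (l + m) y) ∧
      ∀ m : ℕ, m < 5 → ∀ d, T.rev d ∈ W (l + m + 3) → T.origin d = y →
        ∃ q, p m ≤ q ∧ q ≤ p (m + 1) ∧ (T.rot ^ q) (out W l y) = d := by
  have hpos := T.minimalPeriod_rot_pos (out W l y)
  set a := out W l y with ha
  set N := Function.minimalPeriod T.rot a with hN
  have hspec := fun i => hW.out_spec i hy
  have hex : ∀ m : ℕ, ∃ n, (m < 5 → n < N ∧ (T.rot ^ n) a = out W (l + m) y) ∧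
      (5 ≤ m → n = N) := by
    intro m
    rcases lt_or_ge m 5 with hm | hm
    · obtain ⟨n, hn, hn'⟩ := T.exists_rot_pow (a := a) (b := out W (l + m) y)
        ((hspec l).2.trans (hspec (l + m)).2.symm)
      exact ⟨n, fun _ => ⟨hn, hn'⟩, fun h => by omega⟩
    · exact ⟨N, fun h => by omega, fun _ => rfl⟩
  choose p hp hp5 using hex
  have hp5 := hp5 5 le_rfl
  have hrot : ∀ m : ℕ, m ≤ 5 → (T.rot ^ p m) a = out W (l + m) y := by
    intro m hm
    rcases hm.lt_or_eq with h | rfl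
    · exact (hp m h).2
    · have h5 : ((5 : ℕ) : ZMod 5) = 0 := by decide
      rw [hp5, T.rot_pow_minimalPeriod, h5, add_zero]
  have hp0 : p 0 = 0 := by
    refine T.rot_pow_inj (hp 0 (by norm_num)).1 hpos ?_
    rw [hrot 0 (by norm_num), Nat.cast_zero, add_zero]
    rfl
  have hne : ∀ m : ℕ, out W (l + m) y ≠ out W (l + (m + 1 : ℕ)) y := by
    intro m h
    have := hW.color_unique (hspec (l + m)).1 (h ▸ (hspec (l + (m + 1 : ℕ))).1)
    push_cast at this
    rw [← add_assoc] at this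
    exact absurd (left_eq_add.1 this) (by decide)
  have hmono : ∀ m : ℕ, m < 5 → p m < p (m + 1) := by
    intro m hm
    rcases (show m + 1 ≤ 5 by omega).lt_or_eq with h | h
    · obtain ⟨r, n, hrn, hn, hr', hn'⟩ := hW.w1_order l m (m + 1) (by omega) h a (hspec l).1 _
        (hspec (l + m)).1 _ (hspec (l + (m + 1 : ℕ))).1 ((hspec l).2.trans (hspec _).2.symm)
        ((hspec l).2.trans (hspec _).2.symm)
      have e1 : r = p m := T.rot_pow_inj (hrn.trans_lt hn) (hp m hm).1 (hr'.trans (hp m hm).2.symm)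
      have e2 : n = p (m + 1) := T.rot_pow_inj hn (hp _ h).1 (hn'.trans (hp _ h).2.symm)
      have e3 : p m ≠ p (m + 1) := fun e => hne m (by rw [← hrot m hm.le, e, hrot _ h.le])
      omega
    · rw [h, hp5]; exact (hp m hm).1
  refine ⟨p, hp0, hp5, hmono, hrot, fun m hm d hd hdy => ?_⟩
  have c1 : l + (m : ZMod 5) + 3 + 2 = l + m := by
    have : (3 + 2 : ZMod 5) = 0 := by decide
    rw [add_assoc, this, add_zero]
  have c2 : l + (m : ZMod 5) + 3 + 3 = l + (m + 1 : ℕ) := by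
    have : (3 + 3 : ZMod 5) = 1 := by decide
    rw [add_assoc, this]; push_cast; ring
  have htgt : T.target (T.rev d) = y := by rw [T.target_rev, hdy]
  obtain ⟨r, n, hrn, hn, hr', hn'⟩ := hW.w2 _ _ hd (out W (l + m) y) (c1.symm ▸ (hspec _).1)
    (out W (l + (m + 1 : ℕ)) y) (c2.symm ▸ (hspec _).1) ((hspec _).2.trans htgt.symm)
    ((hspec _).2.trans htgt.symm)
  have hper : Function.minimalPeriod T.rot (out W (l + m) y) = N := by
    have := T.finite
    rw [← hrot m hm.le, T.rot_pow_eq_iterate]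
    exact Function.minimalPeriod_apply_iterate (T.rot.injective.mem_periodicPts a) _
  rw [hper] at hn
  rw [← hrot m hm.le, ← Equiv.Perm.mul_apply, ← pow_add] at hr' hn'
  rw [T.rev_rev] at hr'
  rw [← hrot (m + 1) hm] at hn'
  have hmod := Nat.modEq_iff_dvd.1 (T.rot_pow_inj_mod hn')
  have hm1 := hmono m hm
  have hNm : p (m + 1) < N ∨ 0 < p m := by
    rcases (show m + 1 ≤ 5 by omega).lt_or_eq with h | h
    · exact Or.inl (hp _ h).1
    · obtain rfl : m = 4 := by omega
      have := hmono 3 (by norm_num)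
      exact Or.inr (by simp only [Nat.reduceAdd] at this; omega)
  have hpm : p m < N := (hp m hm).1
  have hle : p (m + 1) ≤ N := by
    rcases (show m + 1 ≤ 5 by omega).lt_or_eq with h | h
    · exact (hp _ h).1.le
    · rw [h, hp5]
  have hzero := Int.eq_zero_of_abs_lt_dvd hmod (by
    rw [abs_lt]; constructor <;> push_cast <;> omega)
  refine ⟨r + p m, by omega, ?_, hr'⟩
  push_cast at hzero
  omega

/-- If both arcs of an edge are colored, their colors are at distance two. -/
theorem color_rev {i j : ZMod 5} {d : D} (hi : d ∈ W i) (hj : T.rev d ∈ W j) :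
    j = i + 2 ∨ j = i + 3 := by
  have hy : ¬T.IsOuterVertex (T.origin (T.rev d)) := hW.w0_start j _ hj
  obtain ⟨p, hp0, hp5, hmono, hrot, hin⟩ := hW.exists_positions (i + 2) hy
  have c : i + 2 + ((0 : ℕ) : ZMod 5) + 3 = i := by
    have : (2 + 3 : ZMod 5) = 0 := by decide
    rw [Nat.cast_zero, add_zero, add_assoc, this, add_zero]
  obtain ⟨q, hq0, hq1, hq⟩ := hin 0 (by norm_num) (T.rev d) (by rw [c, T.rev_rev]; exact hi) rfl
  obtain ⟨m, hm, rfl⟩ : ∃ m < 5, j = i + 2 + (m : ℕ) :=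
    ⟨(j - (i + 2)).val, ZMod.val_lt _, by rw [ZMod.natCast_zmod_val]; ring⟩
  have h0 := hmono 0 (by norm_num)
  have h1 := hmono 1 (by norm_num)
  have h2 := hmono 2 (by norm_num)
  have h3 := hmono 3 (by norm_num)
  have h4 := hmono 4 (by norm_num)
  simp only [Nat.reduceAdd, zero_add] at h0 h1 h2 h3 h4 hq1
  have hqm : q = p m := by
    refine T.rot_pow_inj (a := out W (i + 2) (T.origin (T.rev d))) (by omega) ?_ ?_
    · interval_cases m <;> omega
    · rw [hq, hrot m hm.le, hW.out_origin hj]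
  have : m ≤ 1 := by
    by_contra hcon
    interval_cases m <;> omega
  interval_cases m
  · left; simp
  · right; push_cast; rw [add_assoc]; congr 1

theorem rev_notMem {i : ZMod 5} {d : D} (hi : d ∈ W i) : T.rev d ∉ W i := by
  intro h
  rcases hW.color_rev hi h with h | h
  · exact absurd (left_eq_add.1 h) (by decide)
  · exact absurd (left_eq_add.1 h) (by decide)

end IsFiveCWood

/-! ### Trapped paths -/

/-- A function on `{0, ..., N}` that decreases, then increases, apart from its first step, and
takes the same value at both ends, attains its maximum at `0` or `1`. -/
theorem le_max_of_valley {F : ℕ → ℝ} {N s : ℕ} (hN : F N = F 0)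
    (h1 : ∀ k, 0 < k → k < s → k < N → F (k + 1) ≤ F k)
    (h2 : ∀ k, 0 < k → s < k → k < N → F k ≤ F (k + 1)) {k : ℕ} (hk : k ≤ N) :
    F k ≤ max (F 0) (F 1) := by
  rcases Nat.eq_zero_or_pos k with rfl | hk0
  · exact le_max_left _ _
  rcases le_or_gt k s with hs | hs
  · refine le_trans ?_ (le_max_right _ _)
    induction k, hk0 using Nat.le_induction with
    | base => exact le_rfl
    | succ k hk1 ih => exact (h1 k hk1 (by omega) (by omega)).trans (ih (by omega) (by omega))
  · refine le_trans ?_ (le_max_left _ _)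
    rw [← hN]
    have key : ∀ j i, 0 < i → s < i → i + j = N → F i ≤ F N := by
      intro j
      induction j with
      | zero => rintro i - - rfl; exact le_rfl
      | succ j ih =>
        intro i hi hsi hij
        exact (h2 i hi hsi (by omega)).trans
          (ih (i + 1) (by omega) (by omega) (by omega))
    exact key (N - k) k hk0 hs (by omega)

/-- The function `w` on the faces traps the color `l` if, at each inner vertex, the maximum of `w`
over the faces around this vertex is attained on a side of the outgoing arc of color `l`. A directed
path of color `l` that touches a set `{w ≥ c}` of faces then runs in the closure of this set. -/
def Traps (W : ZMod 5 → Set D) (w : T.Face → ℝ) (l : ZMod 5) : Prop :=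
  ∀ d, ¬T.IsOuterVertex (T.origin d) → w (T.leftFace d) ≤
    max (w (T.leftFace (out W l (T.origin d)))) (w (T.leftFace (T.rev (out W l (T.origin d)))))

/-- Turning clockwise around an inner vertex from the outgoing arc of color `l`, if the chain `φ` is
first nonpositive, then nonnegative (the change taking place at the outgoing arc of color `l + s`),
then its winding function traps the color `l`. -/
theorem IsFiveCWood.traps {W : ZMod 5 → Set D} (hW : T.IsFiveCWood W) {φ : D → ℝ}
    {w : T.Face → ℝ} (hw : T.IsWinding φ w) (l : ZMod 5) (s : ℕ) (hs : s ≤ 5)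
    (hpos : ∀ d, ¬T.IsOuterVertex (T.origin d) → 0 < φ d →
      (∃ m < 5, (m = 0 ∨ s ≤ m) ∧ d ∈ W (l + (m : ℕ))) ∨
        ∃ m < 5, s ≤ m ∧ T.rev d ∈ W (l + (m : ℕ) + 3))
    (hneg : ∀ d, ¬T.IsOuterVertex (T.origin d) → φ d < 0 →
      (∃ m < 5, m ≤ s ∧ d ∈ W (l + (m : ℕ))) ∨
        ∃ m < 5, m + 1 ≤ s ∧ T.rev d ∈ W (l + (m : ℕ) + 3)) :
    Traps W w l := by
  intro d hd
  obtain ⟨p, hp0, hp5, hmono, hrot, hin⟩ := hW.exists_positions l hd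
  set y := T.origin d with hy
  set a := out W l y with ha
  set N := Function.minimalPeriod T.rot a with hN
  have hao : T.origin a = y := (hW.out_spec l hd).2
  have hpN : ∀ m ≤ 5, ∀ n ≤ 5, m ≤ n → p m ≤ p n := by
    intro m hm n hn hmn
    induction n, hmn using Nat.le_induction with
    | base => exact le_rfl
    | succ n hmn ih => exact (ih (by omega)).trans (hmono n (by omega)).le
  have hplt : ∀ m < 5, p m < N := fun m hm =>
    (hmono m hm).trans_le ((hpN (m + 1) (by omega) 5 le_rfl (by omega)).trans hp5.le)
  -- the position of an outgoing arc, and the possible positions of an incoming one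
  have hout : ∀ k < N, ∀ m < 5, (T.rot ^ k) a ∈ W (l + (m : ℕ)) → k = p m := by
    intro k hk m hm h
    refine T.rot_pow_inj hk (hplt m hm) ?_
    rw [hrot m hm.le, ← hW.out_origin h, T.origin_rot_pow, hao]
  have hinc : ∀ k < N, 0 < k → ∀ m < 5, T.rev ((T.rot ^ k) a) ∈ W (l + (m : ℕ) + 3) →
      p m ≤ k ∧ k ≤ p (m + 1) := by
    intro k hk hk0 m hm h
    obtain ⟨q, h1, h2, h3⟩ := hin m hm _ h (by rw [T.origin_rot_pow, hao])
    have hqN : q ≤ N := h2.trans ((hpN (m + 1) (by omega) 5 le_rfl (by omega)).trans hp5.le)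
    have : k = q := by
      rcases hqN.lt_or_eq with hlt | heq
      · exact (T.rot_pow_inj hlt hk h3).symm
      · rw [heq, T.rot_pow_minimalPeriod] at h3
        have := T.rot_pow_inj (m := 0) (by omega) hk h3
        omega
    omega
  obtain ⟨k, hk, hkd⟩ := T.exists_rot_pow (a := a) (b := d) hao
  have hF : ∀ k, w (T.leftFace ((T.rot ^ (k + 1)) a)) =
      w (T.leftFace ((T.rot ^ k) a)) + φ ((T.rot ^ k) a) := by
    intro k
    rw [pow_succ', Equiv.Perm.mul_apply, hw.rot]
  have hinner : ∀ k, ¬T.IsOuterVertex (T.origin ((T.rot ^ k) a)) := by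
    intro k
    rw [T.origin_rot_pow, hao]
    exact hd
  have key := le_max_of_valley (F := fun k => w (T.leftFace ((T.rot ^ k) a))) (N := N)
    (s := p s) (by simp only [hN, T.rot_pow_minimalPeriod]; rfl) (fun k hk0 hks hkN => ?_)
    (fun k hk0 hks hkN => ?_) hk.le
  · simpa only [hkd, pow_zero, Equiv.Perm.one_apply, pow_one, T.leftFace_rot] using key
  · simp only [hF]
    by_contra hcon
    rcases hpos _ (hinner k) (by linarith) with ⟨m, hm, hms, h⟩ | ⟨m, hm, hms, h⟩
    · have := hout k hkN m hm h
      rcases hms with rfl | hms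
      · omega
      · have := hpN s hs m hm.le hms
        omega
    · have := (hinc k hkN hk0 m hm h).1
      have := hpN s hs m hm.le hms
      omega
  · simp only [hF]
    by_contra hcon
    rcases hneg _ (hinner k) (by linarith) with ⟨m, hm, hms, h⟩ | ⟨m, hm, hms, h⟩
    · have := hout k hkN m hm h
      have := hpN m hm.le s hs hms
      omega
    · have := (hinc k hkN hk0 m hm h).2
      have := hpN (m + 1) (by omega) s hs hms
      omega

/-- Both ends of an arc touch the faces on both sides of this arc. -/
theorem exists_corner_target {w : T.Face → ℝ} {c : ℝ} {e : D}
    (h : c ≤ max (w (T.leftFace e)) (w (T.leftFace (T.rev e)))) :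
    ∃ d, T.origin d = T.target e ∧ c ≤ w (T.leftFace d) := by
  rcases le_max_iff.1 h with h | h
  · exact ⟨T.rot (T.rev e), T.origin_rot _, by rwa [T.leftFace_rot, T.rev_rev]⟩
  · exact ⟨T.rev e, rfl, h⟩

theorem exists_corner_origin {w : T.Face → ℝ} {c : ℝ} {e : D}
    (h : c ≤ max (w (T.leftFace e)) (w (T.leftFace (T.rev e)))) :
    ∃ d, T.origin d = T.origin e ∧ c ≤ w (T.leftFace d) := by
  rcases le_max_iff.1 h with h | h
  · exact ⟨e, rfl, h⟩
  · exact ⟨T.rot e, T.origin_rot _, by rwa [T.leftFace_rot]⟩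

/-- If `w` traps the color `l`, every arc of the path of color `l` from a vertex touching `{w ≥ c}`
has a side in `{w ≥ c}`. -/
theorem Traps.le_max_of_mem_pathArcs {W : ZMod 5 → Set D} (hW : T.IsFiveCWood W)
    {w : T.Face → ℝ} {l : ZMod 5} (hw : Traps W w l) {c : ℝ} {x : T.Vertex}
    (hx : ∃ d, T.origin d = x ∧ c ≤ w (T.leftFace d)) {e : D} (he : e ∈ T.pathArcs W l x) :
    c ≤ max (w (T.leftFace e)) (w (T.leftFace (T.rev e))) := by
  have step : ∀ e ∈ W l, (∃ d, T.origin d = T.origin e ∧ c ≤ w (T.leftFace d)) →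
      c ≤ max (w (T.leftFace e)) (w (T.leftFace (T.rev e))) := by
    rintro e he ⟨d, hd, hc⟩
    have h := hw d (by rw [hd]; exact hW.w0_start l e he)
    rw [hd, hW.out_origin he] at h
    exact hc.trans h
  refine step e he.1 ?_
  obtain ⟨-, hr⟩ := he
  generalize T.origin e = y at hr
  induction hr with
  | refl => exact hx
  | tail _ h ih =>
    obtain ⟨f, hf, rfl, rfl⟩ := h
    exact exists_corner_target (step f hf ih)

end PentagonTriangulation

/-! ### Monochromatic paths end on the outer contour -/

namespace PentagonTriangulation

variable {D : Type*} {T : PentagonTriangulation D}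

open Classical in
/-- The vertex after `x` on the directed path of color `i`; outer vertices are sent to
themselves. -/
noncomputable def nxt (W : ZMod 5 → Set D) (i : ZMod 5) (x : T.Vertex) : T.Vertex :=
  if T.IsOuterVertex x then x else T.target (out W i x)

/-- The arcs met when one starts at `x` and follows the color `i` forever. It is used for vertices
`x` whose path never reaches an outer vertex, where `out` has a junk value. -/
def orbit (W : ZMod 5 → Set D) (i : ZMod 5) (x : T.Vertex) : Set D :=
  {d | ∃ k : ℕ, d = out W i ((nxt W i)^[k] x)}

/-- Enlarging the set of faces that a set of arcs encloses: if each arc of `C'` is an arc of `C`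
or has a side enclosed by `C`, then `C` encloses all that `C'` encloses. -/
theorem enclosedFaces_mono {C C' : Set D}
    (h : ∀ e ∈ C', e ∈ C ∨ T.leftFace e ∈ T.enclosedFaces C ∨
      T.leftFace (T.rev e) ∈ T.enclosedFaces C) :
    T.enclosedFaces C' ⊆ T.enclosedFaces C := by
  have key : ∀ f, Relation.ReflTransGen (T.DualStep C) T.outerFace f →
      Relation.ReflTransGen (T.DualStep C') T.outerFace f := by
    intro f hr
    induction hr with
    | refl => exact .refl
    | tail hg hs ih =>
      have hg' := hg.tail hs
      obtain ⟨d, h1, h2, rfl, rfl⟩ := hs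
      refine ih.tail ⟨d, fun hd => ?_, fun hd => ?_, rfl, rfl⟩
      · rcases h d hd with h | h | h
        · exact h1 h
        · exact h hg
        · exact h hg'
      · rcases h _ hd with h | h | h
        · exact h2 h
        · exact h hg'
        · rw [T.rev_rev] at h; exact h hg
  exact fun f hf hr => hf (key f hr)

theorem nxt_of_inner (W : ZMod 5 → Set D) (i : ZMod 5) {x : T.Vertex}
    (hx : ¬T.IsOuterVertex x) : nxt W i x = T.target (out W i x) := if_neg hx

theorem iterate_nxt_of_outer (W : ZMod 5 → Set D) (i : ZMod 5) {x : T.Vertex}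
    (hx : T.IsOuterVertex x) (n : ℕ) : (nxt W i)^[n] x = x :=
  Function.iterate_fixed (f := nxt W i) (if_pos hx) n

theorem inner_iterate_of_periodic {W : ZMod 5 → Set D} {i : ZMod 5} {x : T.Vertex}
    (hx : ¬T.IsOuterVertex x) {n : ℕ} (hn : 0 < n) (hp : (nxt W i)^[n] x = x) (k : ℕ) :
    ¬T.IsOuterVertex ((nxt W i)^[k] x) := by
  intro hk
  have h1 : (nxt W i)^[n * k] x = x := by
    rw [Function.iterate_mul]; exact Function.iterate_fixed hp k
  have h2 : n * k = (n * k - k) + k := (Nat.sub_add_cancel (Nat.le_mul_of_pos_left k hn)).symm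
  rw [h2, Function.iterate_add_apply, iterate_nxt_of_outer W i hk] at h1
  exact hx (h1 ▸ hk)

theorem mem_of_chain_pos {W : ZMod 5 → Set D} {i : ZMod 5} {C : Set D} (hC : C ⊆ W i) {d : D}
    (h : 0 < T.chain C d) : d ∈ W i := by
  by_contra hd
  exact absurd (T.chain_le_zero fun h => hd (hC h)) (not_le.2 h)

theorem mem_of_chain_neg {W : ZMod 5 → Set D} {i : ZMod 5} {C : Set D} (hC : C ⊆ W i) {d : D}
    (h : T.chain C d < 0) : T.rev d ∈ W i := by
  by_contra hd
  exact absurd (T.chain_nonneg fun h => hd (hC h)) (not_le.2 h)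

/-- If `w` traps the color `l` and is nonpositive around the outer vertices, then the path of color
`l` from a vertex touching `{w ≥ c}`, where `c > 0`, never leaves the closure of this set, hence
never ends: it runs into a directed cycle. -/
theorem exists_periodic_of_traps {W : ZMod 5 → Set D} {w : T.Face → ℝ} {l : ZMod 5}
    (hw : Traps W w l) (hout : ∀ d, T.IsOuterVertex (T.origin d) → w (T.leftFace d) ≤ 0)
    {c : ℝ} (hc : 0 < c) {d : D} (hd : c ≤ w (T.leftFace d)) :
    ∃ x n, ¬T.IsOuterVertex x ∧ 0 < n ∧ (nxt W l)^[n] x = x ∧ ∀ e ∈ orbit W l x,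
      c ≤ max (w (T.leftFace e)) (w (T.leftFace (T.rev e))) := by
  have := T.finite
  have : Finite T.Vertex := Quotient.finite _
  have hinner : ∀ x, (∃ d, T.origin d = x ∧ c ≤ w (T.leftFace d)) → ¬T.IsOuterVertex x := by
    rintro _ ⟨d, rfl, hd⟩ h
    exact absurd (hout d h) (by linarith)
  have hside : ∀ x, (∃ d, T.origin d = x ∧ c ≤ w (T.leftFace d)) →
      c ≤ max (w (T.leftFace (out W l x))) (w (T.leftFace (T.rev (out W l x)))) := by
    rintro x ⟨d, rfl, hd⟩
    exact hd.trans (hw d (hinner _ ⟨d, rfl, hd⟩))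
  have htouch : ∀ k, ∃ e, T.origin e = (nxt W l)^[k] (T.origin d) ∧ c ≤ w (T.leftFace e) := by
    intro k
    induction k with
    | zero => exact ⟨d, rfl, hd⟩
    | succ k ih =>
      rw [Function.iterate_succ_apply', nxt_of_inner W l (hinner _ ih)]
      exact exists_corner_target (hside _ ih)
  obtain ⟨a, b, hab, h⟩ := Finite.exists_ne_map_eq_of_infinite
    (fun k : ℕ => (nxt W l)^[k] (T.origin d))
  wlog hlt : a < b generalizing a b
  · exact this b a hab.symm h.symm (by omega)
  refine ⟨(nxt W l)^[a] (T.origin d), b - a, hinner _ (htouch a), by omega, ?_, ?_⟩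
  · rw [← Function.iterate_add_apply, Nat.sub_add_cancel hlt.le]; exact h.symm
  · rintro _ ⟨k, rfl⟩
    rw [← Function.iterate_add_apply]
    exact hside _ (htouch _)

namespace IsFiveCWood

variable {W : ZMod 5 → Set D} (hW : T.IsFiveCWood W)

include hW

theorem target_eq_outerVertex {i : ZMod 5} {d : D} (hd : d ∈ W i)
    (h : T.IsOuterVertex (T.target d)) : T.target d = T.outerVertex i := by
  obtain ⟨j, hj⟩ := h
  rw [hj, hW.w0_end j i d hd hj]

theorem isSimpleCycle_orbit {i : ZMod 5} {x : T.Vertex} (hx : ¬T.IsOuterVertex x) {n : ℕ}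
    (hn : 0 < n) (hp : (nxt W i)^[n] x = x) : T.IsSimpleCycle (orbit W i x) := by
  have hin := inner_iterate_of_periodic hx hn hp
  have hout := fun k => hW.out_spec i (hin k)
  have htgt : ∀ k, T.target (out W i ((nxt W i)^[k] x)) = (nxt W i)^[k + 1] x := fun k => by
    rw [Function.iterate_succ_apply', nxt_of_inner W i (hin k)]
  have hinj : ∀ k m, (nxt W i)^[k + 1] x = (nxt W i)^[m + 1] x →
      (nxt W i)^[k] x = (nxt W i)^[m] x := by
    intro k m h
    have h' : ∀ k, (nxt W i)^[n - 1] ((nxt W i)^[k + 1] x) = (nxt W i)^[k] x := by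
      intro k
      rw [← Function.iterate_add_apply, show n - 1 + (k + 1) = k + n by omega,
        Function.iterate_add_apply, hp]
    rw [← h' k, h, h' m]
  constructor
  · rintro _ ⟨k, rfl⟩ _ ⟨m, rfl⟩ h
    exact hW.eq_of_origin (hout k).1 (hout m).1 h
  · rintro _ ⟨k, rfl⟩ _ ⟨m, rfl⟩ h
    rw [htgt, htgt] at h
    rw [hinj k m h]
  · rintro _ ⟨k, rfl⟩ ⟨m, h⟩
    exact hW.rev_notMem (hout k).1 (h ▸ (hout m).1)
  · intro p hpp
    have : ∀ k, p (out W i ((nxt W i)^[k] x)) ↔ p (out W i x) := by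
      intro k
      induction k with
      | zero => rfl
      | succ k ih =>
        rw [← ih]
        exact (hpp _ ⟨k, rfl⟩ _ ⟨k + 1, rfl⟩ (by rw [htgt, (hout _).2])).symm
    rintro _ ⟨k, rfl⟩ _ ⟨m, rfl⟩ h
    exact (this m).2 ((this k).1 h)

theorem exists_winding_orbit {i : ZMod 5} {x : T.Vertex} (hx : ¬T.IsOuterVertex x) {n : ℕ}
    (hn : 0 < n) (hp : (nxt W i)^[n] x = x) :
    ∃ w, T.IsWinding (T.chain (orbit W i x)) w ∧ w T.outerFace = 0 ∧
      (∀ f, f ∈ T.enclosedFaces (orbit W i x) ↔ w f ≠ 0) ∧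
      ((w (T.leftFace (out W i x)) = 0 ∧ w (T.leftFace (T.rev (out W i x))) = 1) ∨
        (w (T.leftFace (out W i x)) = -1 ∧ w (T.leftFace (T.rev (out W i x))) = 0)) := by
  have := T.finite
  have := Fintype.ofFinite D
  have hC := hW.isSimpleCycle_orbit hx hn hp
  have hin := inner_iterate_of_periodic hx hn hp
  have hc : out W i x ∈ orbit W i x := ⟨0, rfl⟩
  obtain ⟨w, hw, hw0⟩ := T.isPlane.exists_winding (T.chain_rev (orbit W i x))
    (hC.boundary_chain_eq_zero (by
      rintro _ ⟨k, rfl⟩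
      exact ⟨_, ⟨k + 1, rfl⟩, by
        rw [Function.iterate_succ_apply', nxt_of_inner W i (hin k), (hW.out_spec i ?_).2]
        rw [← nxt_of_inner W i (hin k), ← Function.iterate_succ_apply' (nxt W i)]
        exact hin (k + 1)⟩)) T.outerFace
  have hz : ∀ d, d ∉ orbit W i x → T.rev d ∉ orbit W i x → T.chain (orbit W i x) d = 0 :=
    fun d => T.chain_of_notMem
  refine ⟨w, hw, hw0, fun f => ⟨fun h h0 => h ?_, fun h h' => h ?_⟩, ?_⟩
  · exact hC.reach_of_winding_eq T.isPlane hc hw (hw0.trans h0.symm)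
  · rw [hw.eq_of_reach hz h', hw0]
  · have hjump := hw (out W i x)
    rw [T.chain_of_mem hc (hC.rev_notMem _ hc)] at hjump
    rcases hC.winding_eq_or T.isPlane hc hw T.outerFace with h | h
    · left; constructor <;> linarith
    · right; constructor <;> linarith

/-- There is no directed monochromatic cycle. On such a cycle of color `i`, the arcs of one of the
colors `i + 1` and `i - 1` point strictly inside the cycle; following them, one gets a directed
cycle that encloses fewer faces. -/
theorem acyclic (i : ZMod 5) {x : T.Vertex} (hx : ¬T.IsOuterVertex x) {n : ℕ} (hn : 0 < n) :
    (nxt W i)^[n] x ≠ x := by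
  have := T.finite
  have : Finite T.Face := Quotient.finite _
  intro hp
  induction hN : (T.enclosedFaces (orbit W i x)).ncard using Nat.strong_induction_on
    generalizing i x n with
  | _ N ih =>
  have hin := inner_iterate_of_periodic hx hn hp
  have hCW : orbit W i x ⊆ W i := by
    rintro _ ⟨k, rfl⟩; exact (hW.out_spec i (hin k)).1
  obtain ⟨w, hw, hw0, henc, hside⟩ := hW.exists_winding_orbit hx hn hp
  have hout : ∀ d, T.IsOuterVertex (T.origin d) → w (T.leftFace d) = 0 := by
    rintro d ⟨k, hk⟩
    refine winding_at_outer hw hw0 hk fun e he => T.chain_of_notMem (fun h => ?_) fun h => ?_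
    · exact hW.w0_start i e (hCW h) ⟨k, he⟩
    · obtain ⟨m, hm⟩ := h
      refine hin (m + 1) ?_
      rw [Function.iterate_succ_apply', nxt_of_inner W i (hin m), ← hm, T.target_rev, he]
      exact ⟨k, rfl⟩
  obtain ⟨l, w', hl, htr, hw'out, ⟨d, hd⟩, hw'⟩ : ∃ (l : ZMod 5) (w' : T.Face → ℝ),
      (l = i + 1 ∨ l = i + 4) ∧ Traps W w' l ∧
      (∀ d, T.IsOuterVertex (T.origin d) → w' (T.leftFace d) ≤ 0) ∧
      (∃ d, 1 ≤ w' (T.leftFace d)) ∧ ∀ f, 1 ≤ w' f → w f ≠ 0 := by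
    have c1 : i + 1 + ((4 : ℕ) : ZMod 5) = i := by rw [add_assoc]; exact add_eq_left.2 (by decide)
    have c2 : i + 1 + ((1 : ℕ) : ZMod 5) + 3 = i := by
      rw [add_assoc, add_assoc]; exact add_eq_left.2 (by decide)
    have c3 : i + 4 + ((3 : ℕ) : ZMod 5) + 3 = i := by
      rw [add_assoc, add_assoc]; exact add_eq_left.2 (by decide)
    have c4 : i + 4 + ((1 : ℕ) : ZMod 5) = i := by rw [add_assoc]; exact add_eq_left.2 (by decide)
    rcases hside with ⟨-, h⟩ | ⟨h, -⟩
    · refine ⟨i + 1, w, Or.inl rfl, hW.traps hw (i + 1) 3 (by norm_num) (fun d _ h => ?_)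
        (fun d _ h => ?_), fun d hd => (hout d hd).le, ⟨_, h.ge⟩, fun f hf => by linarith⟩
      · exact Or.inl ⟨4, by norm_num, by norm_num, c1.symm ▸ mem_of_chain_pos hCW h⟩
      · exact Or.inr ⟨1, by norm_num, by norm_num, c2.symm ▸ mem_of_chain_neg hCW h⟩
    · refine ⟨i + 4, -w, Or.inr rfl, hW.traps hw.neg (i + 4) 2 (by norm_num) (fun d _ h => ?_)
        (fun d _ h => ?_), fun d hd => ?_, ⟨out W i x, ?_⟩, fun f hf h0 => ?_⟩
      · rw [Pi.neg_apply, neg_pos] at h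
        exact Or.inr ⟨3, by norm_num, by norm_num, c3.symm ▸ mem_of_chain_neg hCW h⟩
      · rw [Pi.neg_apply, neg_lt_zero] at h
        exact Or.inl ⟨1, by norm_num, by norm_num, c4.symm ▸ mem_of_chain_pos hCW h⟩
      · rw [Pi.neg_apply, hout d hd, neg_zero]
      · rw [Pi.neg_apply, h, neg_neg]
      · rw [Pi.neg_apply, h0] at hf
        norm_num at hf
  obtain ⟨x', n', hx', hn', hp', hmem⟩ := exists_periodic_of_traps htr hw'out one_pos hd
  have hsub : T.enclosedFaces (orbit W l x') ⊆ T.enclosedFaces (orbit W i x) := by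
    refine enclosedFaces_mono fun e he => Or.inr ?_
    rw [henc, henc]
    exact (le_max_iff.1 (hmem e he)).imp (hw' _) (hw' _)
  refine ih _ ?_ l hx' hn' hp' rfl
  rw [← hN]
  refine Set.ncard_lt_ncard (hsub.ssubset_of_ne fun heq => ?_)
  -- if both cycles enclose the same faces, they share an arc, in opposite directions
  obtain ⟨v, -, -, hv, hvside⟩ := hW.exists_winding_orbit hx' hn' hp'
  have hwv : ∀ f, w f = 0 ↔ v f = 0 := by
    intro f
    rw [← not_iff_not, ← Ne, ← Ne, ← henc, ← hv, heq]
  have hjump := hw (out W l x')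
  have hne : T.chain (orbit W i x) (out W l x') ≠ 0 := by
    intro h0
    rw [h0, add_zero] at hjump
    have h1 := hwv (T.leftFace (out W l x'))
    have h2 := hwv (T.leftFace (T.rev (out W l x')))
    rw [hjump, h1] at h2
    rcases hvside with ⟨h3, h4⟩ | ⟨h3, h4⟩ <;> rw [h3, h4] at h2 <;> norm_num at h2
  have hmemW := (hW.out_spec l hx').1
  have hcol : l ≠ i ∧ l ≠ i + 2 ∧ l ≠ i + 3 := by
    rcases hl with rfl | rfl
    · refine ⟨fun h => ?_, fun h => ?_, fun h => ?_⟩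
      · exact absurd (add_eq_left.1 h) (by decide)
      · exact absurd (add_left_cancel h) (by decide)
      · exact absurd (add_left_cancel h) (by decide)
    · refine ⟨fun h => ?_, fun h => ?_, fun h => ?_⟩
      · exact absurd (add_eq_left.1 h) (by decide)
      · exact absurd (add_left_cancel h) (by decide)
      · exact absurd (add_left_cancel h) (by decide)
  rcases hne.lt_or_gt with h | h
  · have h := mem_of_chain_neg hCW h
    rcases hW.color_rev h (by rwa [T.rev_rev]) with h' | h'
    · exact hcol.2.1 h'
    · exact hcol.2.2 h'
  · exact hcol.1 (hW.color_unique hmemW (mem_of_chain_pos hCW h))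

end IsFiveCWood
end PentagonTriangulation

/-! ### The paths and their crossings -/

namespace PentagonTriangulation

variable {D : Type*} {T : PentagonTriangulation D}

namespace IsFiveCWood

variable {W : ZMod 5 → Set D} (hW : T.IsFiveCWood W)

include hW

theorem exists_iterate_outer (i : ZMod 5) (x : T.Vertex) :
    ∃ n, T.IsOuterVertex ((nxt W i)^[n] x) := by
  have := T.finite
  have : Finite T.Vertex := Quotient.finite _
  by_contra! hcon
  obtain ⟨a, b, hab, h⟩ := Finite.exists_ne_map_eq_of_infinite (fun k : ℕ => (nxt W i)^[k] x)
  wlog hlt : a < b generalizing a b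
  · exact this b a hab.symm h.symm (by omega)
  refine hW.acyclic i (hcon a) (n := b - a) (by omega) ?_
  rw [← Function.iterate_add_apply, Nat.sub_add_cancel hlt.le]
  exact h.symm

theorem nxt_eq_outerVertex {i : ZMod 5} {x : T.Vertex} (hx : ¬T.IsOuterVertex x)
    (h : T.IsOuterVertex (nxt W i x)) : nxt W i x = T.outerVertex i := by
  rw [nxt_of_inner W i hx] at h ⊢
  exact hW.target_eq_outerVertex (hW.out_spec i hx).1 h

/-- Induction along the path of color `i`, from its end at the outer vertex `v_i`. -/
theorem path_induction {i : ZMod 5} {p : T.Vertex → Prop} (hout : p (T.outerVertex i))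
    (hstep : ∀ x, ¬T.IsOuterVertex x → p (nxt W i x) → p x) {x : T.Vertex}
    (hx : ¬T.IsOuterVertex x) : p x := by
  obtain ⟨n, hn⟩ := hW.exists_iterate_outer i x
  induction n generalizing x with
  | zero => exact absurd hn hx
  | succ n ih =>
    refine hstep x hx ?_
    by_cases h : T.IsOuterVertex (nxt W i x)
    · rw [hW.nxt_eq_outerVertex hx h]; exact hout
    · exact ih h hn

theorem iterate_eq_outerVertex {i : ZMod 5} {x : T.Vertex} (hx : ¬T.IsOuterVertex x) {n : ℕ}
    (hn : T.IsOuterVertex ((nxt W i)^[n] x)) : (nxt W i)^[n] x = T.outerVertex i := by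
  induction n generalizing x with
  | zero => exact absurd hn hx
  | succ n ih =>
    rw [Function.iterate_succ_apply] at hn ⊢
    by_cases h : T.IsOuterVertex (nxt W i x)
    · rw [iterate_nxt_of_outer W i h]; exact hW.nxt_eq_outerVertex hx h
    · exact ih h hn

theorem mem_pathArcs_iff {i : ZMod 5} {x : T.Vertex} {d : D} :
    d ∈ T.pathArcs W i x ↔
      ∃ k, ¬T.IsOuterVertex ((nxt W i)^[k] x) ∧ d = out W i ((nxt W i)^[k] x) := by
  constructor
  · rintro ⟨hd, hr⟩
    have key : ∀ y, Relation.ReflTransGen (fun a b => ∃ e ∈ W i, T.origin e = a ∧ T.target e = b)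
        x y → ∃ k, (nxt W i)^[k] x = y := by
      intro y hy
      induction hy with
      | refl => exact ⟨0, rfl⟩
      | tail _ h ih =>
        obtain ⟨k, hk⟩ := ih
        obtain ⟨e, he, rfl, rfl⟩ := h
        refine ⟨k + 1, ?_⟩
        rw [Function.iterate_succ_apply', hk, nxt_of_inner W i (hW.w0_start i e he),
          hW.out_origin he]
    obtain ⟨k, hk⟩ := key _ hr
    exact ⟨k, hk ▸ hW.w0_start i d hd, by rw [hk, hW.out_origin hd]⟩
  · rintro ⟨k, hk, rfl⟩
    refine ⟨(hW.out_spec i hk).1, ?_⟩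
    rw [(hW.out_spec i hk).2]
    clear hk
    induction k with
    | zero => exact .refl
    | succ k ih =>
      rw [Function.iterate_succ_apply']
      by_cases h : T.IsOuterVertex ((nxt W i)^[k] x)
      · rwa [nxt, if_pos h]
      · rw [nxt_of_inner W i h]
        exact ih.tail ⟨_, (hW.out_spec i h).1, (hW.out_spec i h).2, rfl⟩

omit hW in
theorem pathArcs_subset (i : ZMod 5) (x : T.Vertex) : T.pathArcs W i x ⊆ W i := fun _ h => h.1

/-- The ends of an arc of the path of color `i` from `x` are consecutive iterates of `x`. -/
theorem exists_iterate_of_mem {i : ZMod 5} {x : T.Vertex} {d : D} (hd : d ∈ T.pathArcs W i x) :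
    ∃ k, T.origin d = (nxt W i)^[k] x ∧ T.target d = (nxt W i)^[k + 1] x := by
  obtain ⟨k, hk, rfl⟩ := hW.mem_pathArcs_iff.1 hd
  exact ⟨k, (hW.out_spec i hk).2, by rw [Function.iterate_succ_apply', nxt_of_inner W i hk]⟩

theorem out_mem_pathArcs (i : ZMod 5) {x : T.Vertex} (hx : ¬T.IsOuterVertex x) :
    out W i x ∈ T.pathArcs W i x := hW.mem_pathArcs_iff.2 ⟨0, hx, rfl⟩

theorem pathArcs_iterate_subset (i : ZMod 5) (x : T.Vertex) (n : ℕ) :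
    T.pathArcs W i ((nxt W i)^[n] x) ⊆ T.pathArcs W i x := by
  intro d hd
  obtain ⟨k, hk, rfl⟩ := hW.mem_pathArcs_iff.1 hd
  rw [← Function.iterate_add_apply] at hk ⊢
  exact hW.mem_pathArcs_iff.2 ⟨_, hk, rfl⟩

theorem pathArcs_of_outer (i : ZMod 5) {x : T.Vertex} (hx : T.IsOuterVertex x) :
    T.pathArcs W i x = ∅ := by
  refine Set.eq_empty_iff_forall_notMem.2 fun d hd => ?_
  obtain ⟨k, hk, -⟩ := hW.mem_pathArcs_iff.1 hd
  rw [iterate_nxt_of_outer W i hx] at hk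
  exact hk hx

theorem pathArcs_eq_insert (i : ZMod 5) {x : T.Vertex} (hx : ¬T.IsOuterVertex x) :
    T.pathArcs W i x = insert (out W i x) (T.pathArcs W i (nxt W i x)) := by
  refine Set.Subset.antisymm (fun d hd => ?_) (Set.insert_subset (hW.out_mem_pathArcs i hx)
    (hW.pathArcs_iterate_subset i x 1))
  obtain ⟨k, hk, rfl⟩ := hW.mem_pathArcs_iff.1 hd
  cases k with
  | zero => exact Set.mem_insert _ _
  | succ k => exact Set.mem_insert_of_mem _ (hW.mem_pathArcs_iff.2 ⟨k, hk, rfl⟩)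

theorem target_injOn_pathArcs {i : ZMod 5} {x : T.Vertex} {d e : D} (hd : d ∈ T.pathArcs W i x)
    (he : e ∈ T.pathArcs W i x) (h : T.target d = T.target e) : d = e := by
  obtain ⟨k, hk, rfl⟩ := hW.mem_pathArcs_iff.1 hd
  obtain ⟨m, hm, rfl⟩ := hW.mem_pathArcs_iff.1 he
  rw [← nxt_of_inner W i hk, ← nxt_of_inner W i hm, ← Function.iterate_succ_apply' (nxt W i),
    ← Function.iterate_succ_apply' (nxt W i)] at h
  wlog hkm : k ≤ m generalizing k m
  · exact (this m hm he k hk hd h.symm (by omega)).symm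
  rcases hkm.lt_or_eq with hlt | rfl
  · exfalso
    have h' : (nxt W i)^[m - k] ((nxt W i)^[k + 1] x) = (nxt W i)^[k + 1] x := by
      rw [← Function.iterate_add_apply, show m - k + (k + 1) = m + 1 by omega]
      exact h.symm
    refine hW.acyclic i (fun hout => hm ?_) (by omega) h'
    rw [show m = (m - (k + 1)) + (k + 1) by omega, Function.iterate_add_apply,
      iterate_nxt_of_outer W i hout]
    exact hout
  · rfl

/-- The boundary of the path from `x` to the outer vertex `v_i`. -/
theorem boundary_pathArcs [Fintype D] (i : ZMod 5) {x : T.Vertex} (hx : ¬T.IsOuterVertex x)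
    (g : T.Vertex → ℝ) :
    T.boundary (T.chain (T.pathArcs W i x)) g = g x - g (T.outerVertex i) := by
  refine hW.path_induction (i := i)
    (p := fun x => T.boundary (T.chain (T.pathArcs W i x)) g = g x - g (T.outerVertex i))
    ?_ (fun x hx ih => ?_) hx
  · rw [hW.pathArcs_of_outer i (T.isOuterVertex_outerVertex i), T.boundary_chain]
    simp
  · classical
    have hnot : out W i x ∉ T.pathArcs W i (nxt W i x) := by
      intro h
      obtain ⟨k, hk, -⟩ := hW.exists_iterate_of_mem h
      rw [(hW.out_spec i hx).2, ← Function.iterate_succ_apply] at hk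
      exact hW.acyclic i hx k.succ_pos hk.symm
    have hind : ∀ d, (T.pathArcs W i x).indicator (1 : D → ℝ) d =
        (if d = out W i x then 1 else 0) + (T.pathArcs W i (nxt W i x)).indicator 1 d := by
      intro d
      rw [hW.pathArcs_eq_insert i hx]
      by_cases hd : d = out W i x
      · subst hd
        simp [hnot]
      · by_cases hd' : d ∈ T.pathArcs W i (nxt W i x) <;> simp [hd, hd']
    rw [T.boundary_chain] at ih ⊢
    simp only [hind, add_mul, Finset.sum_add_distrib, ih, ite_mul, one_mul, zero_mul,
      Finset.sum_ite_eq', Finset.mem_univ, if_true]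
    rw [(hW.out_spec i hx).2, nxt_of_inner W i hx]
    ring

end IsFiveCWood

theorem mem_or_of_chain_sub_pos {A B : Set D} {d : D} (h : 0 < T.chain A d - T.chain B d) :
    d ∈ A ∨ T.rev d ∈ B := by
  by_contra! hcon
  have h1 := T.chain_le_zero hcon.1
  have h2 := T.chain_nonneg hcon.2
  linarith

/-- Trapping criterion for a chain that is the difference of a set of arcs of color `a` and a set
of arcs of color `b` near the inner vertices. -/
theorem IsFiveCWood.traps_of_chain_sub {W : ZMod 5 → Set D} (hW : T.IsFiveCWood W) {φ : D → ℝ}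
    {w : T.Face → ℝ} (hw : T.IsWinding φ w) {a b : ZMod 5} {A B : Set D} (hA : A ⊆ W a)
    (hB : B ⊆ W b)
    (hφ : ∀ d, ¬T.IsOuterVertex (T.origin d) → φ d = T.chain A d - T.chain B d) (l : ZMod 5)
    (s : ℕ) (hs : s ≤ 5) (h1 : ∃ m < 5, (m = 0 ∨ s ≤ m) ∧ a = l + (m : ℕ))
    (h2 : ∃ m < 5, s ≤ m ∧ b = l + (m : ℕ) + 3) (h3 : ∃ m < 5, m ≤ s ∧ b = l + (m : ℕ))
    (h4 : ∃ m < 5, m + 1 ≤ s ∧ a = l + (m : ℕ) + 3) : Traps W w l := by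
  obtain ⟨m1, hm1, hs1, e1⟩ := h1
  obtain ⟨m2, hm2, hs2, e2⟩ := h2
  obtain ⟨m3, hm3, hs3, e3⟩ := h3
  obtain ⟨m4, hm4, hs4, e4⟩ := h4
  refine hW.traps hw l s hs (fun d hd h => ?_) (fun d hd h => ?_)
  · rcases mem_or_of_chain_sub_pos (hφ d hd ▸ h) with h | h
    · exact Or.inl ⟨m1, hm1, hs1, e1 ▸ hA h⟩
    · exact Or.inr ⟨m2, hm2, hs2, e2 ▸ hB h⟩
  · have h : 0 < T.chain B d - T.chain A d := by rw [hφ d hd] at h; linarith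
    rcases mem_or_of_chain_sub_pos h with h | h
    · exact Or.inl ⟨m3, hm3, hs3, e3 ▸ hB h⟩
    · exact Or.inr ⟨m4, hm4, hs4, e4 ▸ hA h⟩

theorem boundary_add [Fintype D] (φ ψ : D → ℝ) (g : T.Vertex → ℝ) :
    T.boundary (φ + ψ) g = T.boundary φ g + T.boundary ψ g := by
  simp only [CombMap.boundary, Pi.add_apply, add_mul, Finset.sum_add_distrib]

theorem boundary_sub [Fintype D] (φ ψ : D → ℝ) (g : T.Vertex → ℝ) :
    T.boundary (φ - ψ) g = T.boundary φ g - T.boundary ψ g := by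
  simp only [CombMap.boundary, Pi.sub_apply, sub_mul, Finset.sum_sub_distrib]

theorem chain_diff {A B : Set D} (h : B ⊆ A) : T.chain (A \ B) = T.chain A - T.chain B := by
  have key : ∀ d, (A \ B).indicator (1 : D → ℝ) d = A.indicator 1 d - B.indicator 1 d := by
    intro d
    by_cases hB : d ∈ B
    · simp [hB, h hB]
    · by_cases hA : d ∈ A <;> simp [hA, hB]
  funext d
  simp only [CombMap.chain, Pi.sub_apply, key]
  ring

namespace IsFiveCWood

variable {W : ZMod 5 → Set D} (hW : T.IsFiveCWood W)

include hW

/-- The part of a path that precedes one of its inner vertices avoids the outer vertices. -/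
theorem chain_diff_eq_zero {i : ZMod 5} {x : T.Vertex} {n : ℕ}
    (hn : ¬T.IsOuterVertex ((nxt W i)^[n] x)) {d : D} (hd : T.IsOuterVertex (T.origin d)) :
    T.chain (T.pathArcs W i x \ T.pathArcs W i ((nxt W i)^[n] x)) d = 0 := by
  refine T.chain_of_notMem (fun h => hW.w0_start i d h.1.1 hd) fun h => h.2 ?_
  obtain ⟨k, hk, hkd⟩ := hW.mem_pathArcs_iff.1 h.1
  have hk1 : T.IsOuterVertex ((nxt W i)^[k + 1] x) := by
    rw [Function.iterate_succ_apply', nxt_of_inner W i hk, ← hkd, T.target_rev]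
    exact hd
  have hnk : n ≤ k := by
    by_contra hlt
    refine hn ?_
    rw [show n = (n - (k + 1)) + (k + 1) by omega, Function.iterate_add_apply,
      iterate_nxt_of_outer W i hk1]
    exact hk1
  refine hW.mem_pathArcs_iff.2 ⟨k - n, ?_, ?_⟩
  · rwa [← Function.iterate_add_apply, Nat.sub_add_cancel hnk]
  · rwa [← Function.iterate_add_apply, Nat.sub_add_cancel hnk]

/-- Two paths of consecutive colors starting at `x` meet only at `x`. Otherwise, let `w` be the
winding function of the closed walk that they form up to a common vertex `y`: then `w` traps the
color `a`, and `-w` traps the color `a + 3`, so that `w = 0`. -/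
theorem eq_of_iterate_eq (a : ZMod 5) {x : T.Vertex} (hx : ¬T.IsOuterVertex x) {k m : ℕ}
    (h : (nxt W a)^[k] x = (nxt W (a + 1))^[m] x) : (nxt W a)^[k] x = x := by
  have := T.finite
  have := Fintype.ofFinite D
  by_contra hne
  have hy : ¬T.IsOuterVertex ((nxt W a)^[k] x) := by
    intro hout
    have h1 := hW.iterate_eq_outerVertex hx hout
    have h2 := hW.iterate_eq_outerVertex hx (h ▸ hout)
    rw [← h, h1] at h2
    exact absurd (left_eq_add.1 (T.outerVertex_injective h2)) (by decide)
  have hy' : ¬T.IsOuterVertex ((nxt W (a + 1))^[m] x) := h ▸ hy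
  set A := T.pathArcs W a x \ T.pathArcs W a ((nxt W a)^[k] x) with hA
  set B := T.pathArcs W (a + 1) x \ T.pathArcs W (a + 1) ((nxt W (a + 1))^[m] x) with hB
  have hAW : A ⊆ W a := fun d hd => hd.1.1
  have hBW : B ⊆ W (a + 1) := fun d hd => hd.1.1
  obtain ⟨w, hw, hw0⟩ := T.isPlane.exists_winding (φ := T.chain A - T.chain B)
    (fun d => by rw [Pi.sub_apply, Pi.sub_apply, T.chain_rev, T.chain_rev]; ring)
    (fun g => by
      rw [hA, hB, boundary_sub, chain_diff (hW.pathArcs_iterate_subset a x k),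
        chain_diff (hW.pathArcs_iterate_subset (a + 1) x m), boundary_sub, boundary_sub,
        hW.boundary_pathArcs a hx, hW.boundary_pathArcs a hy, hW.boundary_pathArcs (a + 1) hx,
        hW.boundary_pathArcs (a + 1) hy', h]
      ring) T.outerFace
  have hout : ∀ d, T.IsOuterVertex (T.origin d) → w (T.leftFace d) = 0 := by
    rintro d ⟨j, hj⟩
    refine winding_at_outer hw hw0 hj fun e he => ?_
    rw [Pi.sub_apply, hW.chain_diff_eq_zero hy ⟨j, he⟩, hW.chain_diff_eq_zero hy' ⟨j, he⟩,
      sub_zero]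
  have hnot : ∀ {w' : T.Face → ℝ} {l : ZMod 5}, Traps W w' l →
      (∀ d, T.IsOuterVertex (T.origin d) → w' (T.leftFace d) ≤ 0) → ∀ d, w' (T.leftFace d) ≤ 0 := by
    intro w' l htr ho d
    by_contra! hd
    obtain ⟨z, n, hz, hn, hp, -⟩ := exists_periodic_of_traps htr ho hd le_rfl
    exact hW.acyclic l hz hn hp
  have hpos := hnot (hW.traps_of_chain_sub hw hAW hBW (fun d _ => rfl) a 3 (by norm_num)
    ⟨0, by norm_num, Or.inl rfl, by simp⟩
    ⟨3, by norm_num, le_rfl, by rw [add_assoc]; congr 1⟩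
    ⟨1, by norm_num, by norm_num, by simp⟩
    ⟨2, by norm_num, by norm_num, by rw [add_assoc]; exact left_eq_add.2 (by decide)⟩)
    (fun d hd => (hout d hd).le)
  have hneg := hnot (hW.traps_of_chain_sub hw.neg hBW hAW
    (fun d _ => by rw [Pi.neg_apply, Pi.sub_apply, neg_sub]) (a + 3) 2 (by norm_num)
    ⟨3, by norm_num, Or.inr (by norm_num), by rw [add_assoc]; congr 1⟩
    ⟨4, by norm_num, by norm_num, by
      rw [add_assoc, add_assoc]; exact left_eq_add.2 (by decide)⟩
    ⟨2, by norm_num, by norm_num, by rw [add_assoc]; exact left_eq_add.2 (by decide)⟩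
    ⟨0, by norm_num, by norm_num, by rw [add_assoc, add_assoc]; congr 1⟩)
    (fun d hd => by rw [Pi.neg_apply, hout d hd, neg_zero])
  have hzero : ∀ d, w (T.leftFace d) = 0 := fun d =>
    le_antisymm (hpos d) (by have := hneg d; rw [Pi.neg_apply] at this; linarith)
  -- the first arc of the path of color `a` has a positive coefficient
  have hspec := hW.out_spec a hx
  have hmem : out W a x ∈ A := by
    refine ⟨hW.out_mem_pathArcs a hx, fun hmem => ?_⟩
    obtain ⟨j, hj, -⟩ := hW.exists_iterate_of_mem hmem
    rw [hspec.2, ← Function.iterate_add_apply] at hj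
    rcases Nat.eq_zero_or_pos (j + k) with h0 | h0
    · obtain rfl : k = 0 := by omega
      exact hne rfl
    · exact hW.acyclic a hx h0 hj.symm
  have h1 := T.chain_of_mem hmem fun h => hW.rev_notMem hspec.1 (hAW h)
  have h2 : T.chain B (out W a x) ≤ 0 := T.chain_le_zero fun h =>
    absurd (left_eq_add.1 (hW.color_unique hspec.1 (hBW h))) (by decide)
  have h3 := hw (out W a x)
  rw [hzero, hzero, Pi.sub_apply, h1] at h3
  linarith

end IsFiveCWood
end PentagonTriangulation

/-! ### The regions -/

namespace PentagonTriangulation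

variable {D : Type*} {T : PentagonTriangulation D}

/-- The contour of the region between the paths of colors `a` and `a + 1` from `x`, directed so that
the region is on its right. -/
def orientedContour (W : ZMod 5 → Set D) (a : ZMod 5) (x : T.Vertex) : Set D :=
  T.pathArcs W a x ∪ {T.outer a} ∪ T.rev ⁻¹' T.pathArcs W (a + 1) x

/-- The chain of the directed contour of the region `R_i(x)`. -/
noncomputable def regionChain (W : ZMod 5 → Set D) (i : ZMod 5) (x : T.Vertex) : D → ℝ :=
  T.chain (T.pathArcs W (i + 2) x) - T.chain (T.pathArcs W (i + 3) x) + T.chain {T.outer (i + 2)}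

/-- The indicator function of the set of faces of the region `R_i(x)`. -/
noncomputable def regionInd (W : ZMod 5 → Set D) (i : ZMod 5) (x : T.Vertex) : T.Face → ℝ :=
  (T.regionFaces W i x).indicator 1

theorem regionInd_nonneg (W : ZMod 5 → Set D) (i : ZMod 5) (x : T.Vertex) (f : T.Face) :
    0 ≤ regionInd W i x f :=
  Set.indicator_nonneg (fun _ _ => zero_le_one) f

theorem regionInd_of_mem {W : ZMod 5 → Set D} {i : ZMod 5} {x : T.Vertex} {f : T.Face}
    (h : f ∈ T.regionFaces W i x) : regionInd W i x f = 1 := by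
  simp [regionInd, h]

theorem regionInd_of_notMem {W : ZMod 5 → Set D} {i : ZMod 5} {x : T.Vertex} {f : T.Face}
    (h : f ∉ T.regionFaces W i x) : regionInd W i x f = 0 := by
  simp [regionInd, h]

theorem sub_two_eq (i : ZMod 5) : i - 2 = i + 3 := by
  rw [sub_eq_add_neg]; congr 1

theorem isOuterVertex_origin_outer (i : ZMod 5) : T.IsOuterVertex (T.origin (T.outer i)) :=
  ⟨i, rfl⟩

theorem isOuterVertex_target_outer (i : ZMod 5) : T.IsOuterVertex (T.target (T.outer i)) :=
  ⟨i + 1, T.target_outer i⟩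

theorem chain_outer_of_inner {d : D} (hd : ¬T.IsOuterVertex (T.origin d)) (a : ZMod 5) :
    T.chain {T.outer a} d = 0 := by
  refine T.chain_of_notMem (fun h => hd ?_) fun h => hd ?_
  · rw [Set.mem_singleton_iff.1 h]; exact isOuterVertex_origin_outer a
  · rw [← T.target_rev, Set.mem_singleton_iff.1 h]; exact isOuterVertex_target_outer a

theorem dualStep_congr {C C' : Set D}
    (h : ∀ d, (d ∈ C ∨ T.rev d ∈ C) ↔ (d ∈ C' ∨ T.rev d ∈ C')) :
    T.DualStep C = T.DualStep C' := by
  funext f g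
  refine propext (exists_congr fun d => ?_)
  rw [← and_assoc, ← not_or, h d, not_or, and_assoc]

theorem regionFaces_of_inner (W : ZMod 5 → Set D) (i : ZMod 5) {x : T.Vertex}
    (hx : ¬T.IsOuterVertex x) :
    T.regionFaces W i x = T.enclosedFaces (T.regionContour W i x) := by
  rw [regionFaces, if_neg (fun h => hx ⟨i, h⟩), if_neg hx]

theorem mem_regionContour_iff (W : ZMod 5 → Set D) (i : ZMod 5) (x : T.Vertex) (d : D) :
    (d ∈ T.regionContour W i x ∨ T.rev d ∈ T.regionContour W i x) ↔
      (d ∈ orientedContour W (i + 2) x ∨ T.rev d ∈ orientedContour W (i + 2) x) := by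
  have h : i + 2 + 1 = i + 3 := by rw [add_assoc]; congr 1
  simp only [regionContour, orientedContour, sub_two_eq, h, Set.mem_union, Set.mem_preimage,
    T.rev_rev]
  tauto

theorem dualStep_regionContour (W : ZMod 5 → Set D) (i : ZMod 5) (x : T.Vertex) :
    T.DualStep (T.regionContour W i x) = T.DualStep (orientedContour W (i + 2) x) :=
  dualStep_congr (mem_regionContour_iff W i x)

theorem outerFace_notMem_regionFaces (W : ZMod 5 → Set D) (i : ZMod 5) (x : T.Vertex) :
    T.outerFace ∉ T.regionFaces W i x := by
  rw [regionFaces]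
  split_ifs
  · exact fun h => h rfl
  · exact fun h => h
  · exact fun h => h .refl

namespace IsFiveCWood

variable {W : ZMod 5 → Set D} (hW : T.IsFiveCWood W)

include hW

theorem origin_ne_target (a : ZMod 5) {x : T.Vertex} (hx : ¬T.IsOuterVertex x) {d e : D}
    (hd : d ∈ T.pathArcs W a x) (he : e ∈ T.pathArcs W (a + 1) x) :
    T.origin d ≠ T.target e ∧ T.target d ≠ T.origin e := by
  obtain ⟨k, hk, hk'⟩ := hW.exists_iterate_of_mem hd
  obtain ⟨m, hm, hm'⟩ := hW.exists_iterate_of_mem he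
  constructor
  · intro h
    have h1 := hW.eq_of_iterate_eq a hx (hk.symm.trans (h.trans hm'))
    exact hW.acyclic (a + 1) hx m.succ_pos (by rw [← hm', ← h, hk, h1])
  · intro h
    have h1 := hW.eq_of_iterate_eq a hx (hk'.symm.trans (h.trans hm))
    exact hW.acyclic a hx k.succ_pos h1

theorem isSimpleCycle_orientedContour (a : ZMod 5) {x : T.Vertex} (hx : ¬T.IsOuterVertex x) :
    T.IsSimpleCycle (orientedContour W a x) := by
  have hstart : ∀ {i d}, d ∈ T.pathArcs W i x → ¬T.IsOuterVertex (T.origin d) :=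
    fun {i d} h => hW.w0_start i d h.1
  have hend : ∀ {d}, d ∈ T.pathArcs W a x → T.target d ≠ T.target (T.outer a) := by
    intro d hd h
    have := hW.w0_end (a + 1) a d hd.1 (h.trans (T.target_outer a))
    exact absurd (left_eq_add.1 this) (by decide)
  have hend' : ∀ {d}, d ∈ T.pathArcs W (a + 1) x → T.target d ≠ T.origin (T.outer a) := by
    intro d hd h
    have := hW.w0_end a (a + 1) d hd.1 h
    exact absurd (add_eq_left.1 this) (by decide)
  have horigin : ∀ d, T.origin d = T.target (T.rev d) := fun d => (T.target_rev d).symm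
  constructor
  · rintro d ((hd | hd) | hd) e ((he | he) | he) h
    · exact hW.eq_of_origin hd.1 he.1 h
    · rw [Set.mem_singleton_iff.1 he] at h
      exact absurd (h ▸ isOuterVertex_origin_outer a) (hstart hd)
    · rw [horigin e] at h
      exact absurd h (hW.origin_ne_target a hx hd he).1
    · rw [Set.mem_singleton_iff.1 hd] at h
      exact absurd (h ▸ isOuterVertex_origin_outer a) (hstart he)
    · rw [Set.mem_singleton_iff.1 hd, Set.mem_singleton_iff.1 he]
    · rw [Set.mem_singleton_iff.1 hd, horigin e] at h
      exact absurd h.symm (hend' he)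
    · rw [horigin d] at h
      exact absurd h.symm (hW.origin_ne_target a hx he hd).1
    · rw [Set.mem_singleton_iff.1 he, horigin d] at h
      exact absurd h (hend' hd)
    · rw [horigin d, horigin e] at h
      exact T.rev_injective (hW.target_injOn_pathArcs hd he h)
  · rintro d ((hd | hd) | hd) e ((he | he) | he) h
    · exact hW.target_injOn_pathArcs hd he h
    · rw [Set.mem_singleton_iff.1 he] at h
      exact absurd h (hend hd)
    · exact absurd h (hW.origin_ne_target a hx hd he).2
    · rw [Set.mem_singleton_iff.1 hd] at h
      exact absurd h.symm (hend he)
    · rw [Set.mem_singleton_iff.1 hd, Set.mem_singleton_iff.1 he]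
    · rw [Set.mem_singleton_iff.1 hd] at h
      have h' : T.IsOuterVertex (T.target e) := h ▸ isOuterVertex_target_outer a
      exact absurd h' (hstart he)
    · exact absurd h.symm (hW.origin_ne_target a hx he hd).2
    · rw [Set.mem_singleton_iff.1 he] at h
      have h' : T.IsOuterVertex (T.target d) := h ▸ isOuterVertex_target_outer a
      exact absurd h' (hstart hd)
    · exact T.rev_injective (hW.eq_of_origin hd.1 he.1 h)
  · have hin : ∀ {i d}, d ∈ T.pathArcs W i x → T.IsInnerArc d := fun {i d} h => hW.inner i d h.1
    have hcol : ∀ {d}, d ∈ T.pathArcs W a x → d ∉ T.pathArcs W (a + 1) x := fun h h' =>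
      absurd (left_eq_add.1 (hW.color_unique h.1 h'.1)) (by decide)
    rintro d ((hd | hd) | hd) ((he | he) | he)
    · exact hW.rev_notMem hd.1 he.1
    · exact (hin hd).2 ⟨a, (Set.mem_singleton_iff.1 he).symm⟩
    · rw [Set.mem_preimage, T.rev_rev] at he
      exact hcol hd he
    · exact (hin he).2 ⟨a, by rw [T.rev_rev, Set.mem_singleton_iff.1 hd]⟩
    · rw [Set.mem_singleton_iff.1 hd] at he
      exact T.rev_outer_ne a a he
    · rw [Set.mem_preimage, T.rev_rev] at he
      exact (hin he).1 ⟨a, (Set.mem_singleton_iff.1 hd).symm⟩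
    · exact hcol he hd
    · exact (hin hd).1 ⟨a, (Set.mem_singleton_iff.1 he).symm⟩
    · rw [Set.mem_preimage, T.rev_rev] at he
      exact hW.rev_notMem he.1 hd.1
  · intro p hp
    -- both paths are followed from their ends, which are the ends of the arc `outer a`
    have hA : ∀ z, ¬T.IsOuterVertex z → out W a z ∈ T.pathArcs W a x →
        (p (out W a z) ↔ p (T.outer a)) := by
      intro z hz
      refine hW.path_induction (i := a) (p := fun z => ¬T.IsOuterVertex z →
        out W a z ∈ T.pathArcs W a x → (p (out W a z) ↔ p (T.outer a)))
        (fun h => absurd (T.isOuterVertex_outerVertex a) h) (fun z hz ih _ hm => ?_) hz hz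
      by_cases hn : T.IsOuterVertex (nxt W a z)
      · have := hW.nxt_eq_outerVertex hz hn
        rw [nxt_of_inner W a hz] at this
        exact hp _ (Or.inl (Or.inl hm)) _ (Or.inl (Or.inr rfl)) this
      · have hm' : out W a (nxt W a z) ∈ T.pathArcs W a x := by
          obtain ⟨k, hk, hk'⟩ := hW.mem_pathArcs_iff.1 hm
          have hzk : (nxt W a)^[k] x = z := by
            rw [← (hW.out_spec a hz).2, hk', (hW.out_spec a hk).2]
          refine hW.mem_pathArcs_iff.2 ⟨k + 1, ?_, ?_⟩ <;>
            rw [Function.iterate_succ_apply', hzk]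
          exact hn
        rw [← ih hn hm']
        refine hp _ (Or.inl (Or.inl hm)) _ (Or.inl (Or.inl hm')) ?_
        rw [(hW.out_spec a hn).2, nxt_of_inner W a hz]
    have hB : ∀ z, ¬T.IsOuterVertex z → out W (a + 1) z ∈ T.pathArcs W (a + 1) x →
        (p (T.rev (out W (a + 1) z)) ↔ p (T.outer a)) := by
      intro z hz
      refine hW.path_induction (i := a + 1) (p := fun z => ¬T.IsOuterVertex z →
        out W (a + 1) z ∈ T.pathArcs W (a + 1) x → (p (T.rev (out W (a + 1) z)) ↔ p (T.outer a)))
        (fun h => absurd (T.isOuterVertex_outerVertex (a + 1)) h) (fun z hz ih _ hm => ?_) hz hz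
      have hr : ∀ {d}, d ∈ T.pathArcs W (a + 1) x → T.rev d ∈ orientedContour W a x := by
        intro d hd
        exact Or.inr (by rwa [Set.mem_preimage, T.rev_rev])
      by_cases hn : T.IsOuterVertex (nxt W (a + 1) z)
      · have := hW.nxt_eq_outerVertex hz hn
        rw [nxt_of_inner W (a + 1) hz] at this
        exact (hp _ (Or.inl (Or.inr rfl)) _ (hr hm) ((T.target_outer a).trans this.symm)).symm
      · have hm' : out W (a + 1) (nxt W (a + 1) z) ∈ T.pathArcs W (a + 1) x := by
          obtain ⟨k, hk, hk'⟩ := hW.mem_pathArcs_iff.1 hm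
          have hzk : (nxt W (a + 1))^[k] x = z := by
            rw [← (hW.out_spec (a + 1) hz).2, hk', (hW.out_spec (a + 1) hk).2]
          refine hW.mem_pathArcs_iff.2 ⟨k + 1, ?_, ?_⟩ <;>
            rw [Function.iterate_succ_apply', hzk]
          exact hn
        rw [← ih hn hm']
        refine (hp _ (hr hm') _ (hr hm) ?_).symm
        rw [T.target_rev, (hW.out_spec (a + 1) hn).2, nxt_of_inner W (a + 1) hz]
        rfl
    have hall : ∀ d ∈ orientedContour W a x, p d ↔ p (T.outer a) := by
      rintro d ((hd | hd) | hd)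
      · have h := hA (T.origin d) (hstart hd)
        rw [hW.out_origin hd.1] at h
        exact h hd
      · rw [Set.mem_singleton_iff.1 hd]
      · have h := hB (T.origin (T.rev d)) (hstart hd)
        rw [hW.out_origin hd.1, T.rev_rev] at h
        exact h hd
    exact fun d hd e he h => (hall e he).2 ((hall d hd).1 h)

theorem chain_orientedContour (i : ZMod 5) {x : T.Vertex} (hx : ¬T.IsOuterVertex x) :
    T.chain (orientedContour W (i + 2) x) = regionChain W i x := by
  have h3 : i + 2 + 1 = i + 3 := by rw [add_assoc]; congr 1
  have key : ∀ d, (orientedContour W (i + 2) x).indicator (1 : D → ℝ) d =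
      (T.pathArcs W (i + 2) x).indicator 1 d + ({T.outer (i + 2)} : Set D).indicator 1 d +
        (T.pathArcs W (i + 3) x).indicator 1 (T.rev d) := by
    intro d
    have h1 : d ∈ T.pathArcs W (i + 2) x → d ∉ ({T.outer (i + 2)} : Set D) := fun h h' =>
      (hW.inner _ _ h.1).1 ⟨_, (Set.mem_singleton_iff.1 h').symm⟩
    have h2 : T.rev d ∈ T.pathArcs W (i + 3) x → d ∉ ({T.outer (i + 2)} : Set D) := fun h h' =>
      (hW.inner _ _ h.1).2 ⟨_, by rw [T.rev_rev, Set.mem_singleton_iff.1 h']⟩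
    have h4 : d ∈ T.pathArcs W (i + 2) x → T.rev d ∉ T.pathArcs W (i + 3) x := fun h h' =>
      (hW.origin_ne_target (i + 2) hx h (h3.symm ▸ h')).1 (T.target_rev d).symm
    have hmem : d ∈ orientedContour W (i + 2) x ↔ (d ∈ T.pathArcs W (i + 2) x ∨
        d ∈ ({T.outer (i + 2)} : Set D)) ∨ T.rev d ∈ T.pathArcs W (i + 3) x := by
      rw [orientedContour, h3]; rfl
    classical
    simp only [Set.indicator_apply, hmem, Pi.one_apply]
    by_cases e1 : d ∈ T.pathArcs W (i + 2) x <;>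
    by_cases e2 : d ∈ ({T.outer (i + 2)} : Set D) <;>
    by_cases e3 : T.rev d ∈ T.pathArcs W (i + 3) x <;> simp_all
  funext d
  simp only [regionChain, CombMap.chain, Pi.add_apply, Pi.sub_apply, key, T.rev_rev]
  ring

/-- The indicator function of a region is the winding function of its contour, and the faces of the
region are connected to the inner face at its outer edge without crossing the contour. -/
theorem region_spec (i : ZMod 5) {x : T.Vertex} (hx : ¬T.IsOuterVertex x) :
    T.IsWinding (regionChain W i x) (regionInd W i x) ∧
      T.leftFace (T.rev (T.outer (i + 2))) ∈ T.regionFaces W i x ∧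
      ∀ f ∈ T.regionFaces W i x, Relation.ReflTransGen (T.DualStep (T.regionContour W i x))
        (T.leftFace (T.rev (T.outer (i + 2)))) f := by
  have := T.finite
  have := Fintype.ofFinite D
  have hC := hW.isSimpleCycle_orientedContour (i + 2) hx
  have h3 : i + 2 + 1 = i + 3 := by rw [add_assoc]; congr 1
  have ho : T.outer (i + 2) ∈ orientedContour W (i + 2) x := Or.inl (Or.inr rfl)
  obtain ⟨w, hw, hw0⟩ := T.isPlane.exists_winding (φ := regionChain W i x)
    (fun d => by rw [← hW.chain_orientedContour i hx, T.chain_rev])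
    (fun g => by
      rw [regionChain, boundary_add, boundary_sub, hW.boundary_pathArcs _ hx,
        hW.boundary_pathArcs _ hx, T.boundary_chain]
      classical
      simp only [Set.indicator_apply, Set.mem_singleton_iff, Pi.one_apply, ite_mul, one_mul,
        zero_mul, Finset.sum_ite_eq', Finset.mem_univ, if_true]
      rw [T.target_outer, h3, outerVertex, outerVertex]
      ring) T.outerFace
  have hw' := hw
  rw [← hW.chain_orientedContour i hx] at hw'
  have hz : ∀ d, d ∉ orientedContour W (i + 2) x → T.rev d ∉ orientedContour W (i + 2) x →
      T.chain (orientedContour W (i + 2) x) d = 0 := fun d => T.chain_of_notMem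
  have hjump := hw' (T.outer (i + 2))
  rw [T.chain_of_mem ho (hC.rev_notMem _ ho), T.leftFace_outer, hw0, zero_add] at hjump
  have hmem : ∀ f, f ∈ T.regionFaces W i x ↔ w f = 1 := by
    intro f
    rw [regionFaces_of_inner W i hx, enclosedFaces, dualStep_regionContour]
    refine ⟨fun h => ?_, fun h h' => ?_⟩
    · rcases hC.winding_eq_or T.isPlane ho hw' f with h' | h'
      · rw [T.leftFace_outer] at h'
        exact absurd (hC.reach_of_winding_eq T.isPlane ho hw' h'.symm) h
      · rw [h', T.leftFace_outer, hw0, zero_add]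
    · have := hw'.eq_of_reach hz h'
      rw [h, hw0] at this
      norm_num at this
  have hind : regionInd W i x = w := by
    funext f
    by_cases hf : f ∈ T.regionFaces W i x
    · rw [regionInd_of_mem hf, (hmem f).1 hf]
    · rw [regionInd_of_notMem hf]
      rcases hC.winding_eq_or T.isPlane ho hw' f with h' | h'
      · rw [h', T.leftFace_outer, hw0]
      · rw [T.leftFace_outer, hw0, zero_add] at h'
        exact absurd ((hmem f).2 h') hf
  refine ⟨hind ▸ hw, (hmem _).2 hjump, fun f hf => ?_⟩
  rw [dualStep_regionContour]
  exact hC.reach_of_winding_eq T.isPlane ho hw' (hjump.trans ((hmem f).1 hf).symm)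

end IsFiveCWood
end PentagonTriangulation

/-! ### Comparison of the regions of two vertices -/

namespace PentagonTriangulation

variable {D : Type*} {T : PentagonTriangulation D}

theorem regionChain_of_inner (W : ZMod 5 → Set D) (i : ZMod 5) (x : T.Vertex) {d : D}
    (hd : ¬T.IsOuterVertex (T.origin d)) : regionChain W i x d =
      T.chain (T.pathArcs W (i + 2) x) d - T.chain (T.pathArcs W (i + 3) x) d := by
  rw [regionChain, Pi.add_apply, Pi.sub_apply, chain_outer_of_inner hd, add_zero]

theorem mem_or_mem_of_max {S : Set T.Face} {d : D}
    (h : 1 ≤ max (S.indicator (1 : T.Face → ℝ) (T.leftFace d))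
      (S.indicator (1 : T.Face → ℝ) (T.leftFace (T.rev d)))) :
    T.leftFace d ∈ S ∨ T.leftFace (T.rev d) ∈ S := by
  by_contra! hcon
  rw [Set.indicator_of_notMem hcon.1, Set.indicator_of_notMem hcon.2, max_self] at h
  norm_num at h

namespace IsFiveCWood

variable {W : ZMod 5 → Set D} (hW : T.IsFiveCWood W)

include hW

/-- The five regions of an inner vertex partition the inner faces. -/
theorem sum_regionInd {x : T.Vertex} (hx : ¬T.IsOuterVertex x) {f : T.Face}
    (hf : f ≠ T.outerFace) : ∑ i, regionInd W i x f = 1 := by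
  have h1 := CombMap.IsWinding.sum Finset.univ
    (fun i _ => (hW.region_spec i hx).1)
  have h2 : T.IsWinding (∑ i, regionChain W i x) (({T.outerFace}ᶜ : Set T.Face).indicator 1) := by
    intro d
    have e1 : ∑ i, T.chain (T.pathArcs W (i + 2) x) d = ∑ i, T.chain (T.pathArcs W i x) d :=
      Equiv.sum_comp (Equiv.addRight (2 : ZMod 5)) fun i => T.chain (T.pathArcs W i x) d
    have e2 : ∑ i, T.chain (T.pathArcs W (i + 3) x) d = ∑ i, T.chain (T.pathArcs W i x) d :=
      Equiv.sum_comp (Equiv.addRight (3 : ZMod 5)) fun i => T.chain (T.pathArcs W i x) d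
    have e3 : ∑ i, T.chain {T.outer (i + 2)} d = ∑ i, T.chain {T.outer i} d :=
      Equiv.sum_comp (Equiv.addRight (2 : ZMod 5)) fun i => T.chain {T.outer i} d
    have e4 : ∀ d, ∑ i, ({T.outer i} : Set D).indicator (1 : D → ℝ) d =
        1 - ({T.outerFace}ᶜ : Set T.Face).indicator 1 (T.leftFace d) := by
      intro d
      by_cases hd : d ∈ Set.range T.outer
      · obtain ⟨j, rfl⟩ := hd
        have hinj : Function.Injective T.outer := fun a b h =>
          T.outerVertex_injective (by rw [outerVertex, outerVertex, h])
        rw [Set.indicator_of_notMem (by simp [T.leftFace_outer]), sub_zero,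
          Finset.sum_eq_single j (fun i _ hij => Set.indicator_of_notMem (by
            rw [Set.mem_singleton_iff]; exact fun h => hij (hinj h.symm)) _)
            (fun h => absurd (Finset.mem_univ j) h)]
        simp
      · have hd' : T.leftFace d ∈ ({T.outerFace}ᶜ : Set T.Face) := fun h =>
          hd ((T.leftFace_eq_outerFace_iff d).1 h)
        rw [Set.indicator_of_mem hd', Pi.one_apply, sub_self]
        exact Finset.sum_eq_zero fun i _ => Set.indicator_of_notMem
          (fun h => hd ⟨i, (Set.mem_singleton_iff.1 h).symm⟩) _
    simp only [Finset.sum_apply, regionChain, Pi.add_apply, Pi.sub_apply, Finset.sum_add_distrib,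
      Finset.sum_sub_distrib, e1, e2, e3]
    simp only [CombMap.chain, Finset.sum_sub_distrib, e4]
    ring
  have h3 := h1.eq_of_eq_at T.isPlane h2 (f := T.outerFace) (by
    rw [Finset.sum_apply, Finset.sum_eq_zero fun i _ =>
      regionInd_of_notMem (outerFace_notMem_regionFaces W i x)]
    simp) f
  rw [Finset.sum_apply] at h3
  rw [h3, Set.indicator_of_mem (by exact hf), Pi.one_apply]

theorem regionFaces_disjoint {x : T.Vertex} (hx : ¬T.IsOuterVertex x) {i j : ZMod 5} (hij : i ≠ j)
    {f : T.Face} (hi : f ∈ T.regionFaces W i x) : f ∉ T.regionFaces W j x := by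
  intro hj
  have h := hW.sum_regionInd hx (f := f) fun h => outerFace_notMem_regionFaces W i x (h ▸ hi)
  have h2 : ∑ k ∈ {i, j}, regionInd W k x f ≤ ∑ k, regionInd W k x f :=
    Finset.sum_le_sum_of_subset_of_nonneg (Finset.subset_univ _)
      fun k _ _ => regionInd_nonneg W k x f
  rw [Finset.sum_pair hij, regionInd_of_mem hi, regionInd_of_mem hj, h] at h2
  norm_num at h2

theorem exists_corner_of_mem_regionVertices {i : ZMod 5} {u v : T.Vertex}
    (hv : ¬T.IsOuterVertex v) (hu : u ∈ T.regionVertices W i v) :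
    ∃ d, T.origin d = u ∧ 1 ≤ regionInd W i v (T.leftFace d) := by
  rw [regionVertices, if_neg (fun h => hv ⟨i, h⟩), if_neg hv] at hu
  rcases hu with ⟨e, he, heu⟩ | ⟨-, d, hd, hd'⟩
  · have hC := hW.isSimpleCycle_orientedContour (i + 2) hv
    have hw := (hW.region_spec i hv).1
    rw [← hW.chain_orientedContour i hv] at hw
    have hmax : 1 ≤ max (regionInd W i v (T.leftFace e))
        (regionInd W i v (T.leftFace (T.rev e))) := by
      have h0 := regionInd_nonneg W i v (T.leftFace e)
      have h1 := regionInd_nonneg W i v (T.leftFace (T.rev e))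
      rcases (mem_regionContour_iff W i v e).1 (Or.inl he) with h | h
      · have h2 := hw e
        rw [T.chain_of_mem h (hC.rev_notMem e h)] at h2
        exact le_max_of_le_right (by linarith)
      · have h2 := hw (T.rev e)
        rw [T.chain_of_mem h (hC.rev_notMem _ h), T.rev_rev] at h2
        exact le_max_of_le_left (by linarith)
    rcases heu with rfl | rfl
    · exact exists_corner_origin hmax
    · exact exists_corner_target hmax
  · exact ⟨d, hd, (regionInd_of_mem (by rwa [regionFaces_of_inner W i hv])).ge⟩

/-- The paths of colors `i + 2` and `i + 3` from a vertex of `R_i(v)` stay in `R_i(v)`. -/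
theorem side_mem_of_path {i : ZMod 5} {u v : T.Vertex} (hv : ¬T.IsOuterVertex v)
    (hu : u ∈ T.regionVertices W i v) {e : D}
    (he : e ∈ T.pathArcs W (i + 2) u ∨ e ∈ T.pathArcs W (i + 3) u) :
    T.leftFace e ∈ T.regionFaces W i v ∨ T.leftFace (T.rev e) ∈ T.regionFaces W i v := by
  have hcorner := hW.exists_corner_of_mem_regionVertices hv hu
  have hw := (hW.region_spec i hv).1
  have hφ := fun d hd => regionChain_of_inner W i v (d := d) hd
  have h2 : Traps W (regionInd W i v) (i + 2) := hW.traps_of_chain_sub hw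
    (pathArcs_subset (i + 2) v) (pathArcs_subset (i + 3) v) hφ (i + 2) 3 (by norm_num)
    ⟨0, by norm_num, Or.inl rfl, by simp⟩
    ⟨3, by norm_num, le_rfl, by rw [add_assoc, add_assoc]; congr 1⟩
    ⟨1, by norm_num, by norm_num, by rw [add_assoc]; congr 1⟩
    ⟨2, by norm_num, by norm_num, by rw [add_assoc, add_assoc]; congr 1⟩
  have h3 : Traps W (regionInd W i v) (i + 3) := hW.traps_of_chain_sub hw
    (pathArcs_subset (i + 2) v) (pathArcs_subset (i + 3) v) hφ (i + 3) 2 (by norm_num)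
    ⟨4, by norm_num, Or.inr (by norm_num), by rw [add_assoc]; congr 1⟩
    ⟨2, by norm_num, by norm_num, by rw [add_assoc, add_assoc]; congr 1⟩
    ⟨0, by norm_num, by norm_num, by simp⟩
    ⟨1, by norm_num, by norm_num, by rw [add_assoc, add_assoc]; congr 1⟩
  refine mem_or_mem_of_max ?_
  rcases he with he | he
  · exact h2.le_max_of_mem_pathArcs hW hcorner he
  · exact h3.le_max_of_mem_pathArcs hW hcorner he

/-- The path of color `i + 4` from a vertex of `R_i(v)` stays in the union of `R_i(v)` and
`R_{i+1}(v)`, and that of color `i + 1` in the union of `R_i(v)` and `R_{i-1}(v)`. -/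
theorem side_mem_of_path' {i : ZMod 5} {u v : T.Vertex} (hv : ¬T.IsOuterVertex v)
    (hu : u ∈ T.regionVertices W i v) {e : D}
    (he : e ∈ T.pathArcs W (i + 4) u ∨ e ∈ T.pathArcs W (i + 1) u) :
    ∃ j, (j = i ∨ j = i + 1 ∨ j = i + 4) ∧
      (T.leftFace e ∈ T.regionFaces W j v ∨ T.leftFace (T.rev e) ∈ T.regionFaces W j v) := by
  obtain ⟨d₀, hd₀, hc⟩ := hW.exists_corner_of_mem_regionVertices hv hu
  have hcorner : ∀ j, ∃ d, T.origin d = u ∧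
      1 ≤ (regionInd W i v + regionInd W j v) (T.leftFace d) := fun j =>
    ⟨d₀, hd₀, by rw [Pi.add_apply]; linarith [regionInd_nonneg W j v (T.leftFace d₀)]⟩
  have hend : ∀ {j}, 1 ≤ max ((regionInd W i v + regionInd W j v) (T.leftFace e))
      ((regionInd W i v + regionInd W j v) (T.leftFace (T.rev e))) →
      (T.leftFace e ∈ T.regionFaces W i v ∨ T.leftFace (T.rev e) ∈ T.regionFaces W i v) ∨
      (T.leftFace e ∈ T.regionFaces W j v ∨ T.leftFace (T.rev e) ∈ T.regionFaces W j v) := by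
    intro j h
    by_contra! hcon
    obtain ⟨⟨h1, h2⟩, h3, h4⟩ := hcon
    rw [Pi.add_apply, Pi.add_apply, regionInd_of_notMem h1, regionInd_of_notMem h2,
      regionInd_of_notMem h3, regionInd_of_notMem h4] at h
    norm_num at h
  rcases he with he | he
  · have e1 : i + 1 + 2 = i + 3 := by rw [add_assoc]; congr 1
    have e2 : i + 1 + 3 = i + 4 := by rw [add_assoc]; congr 1
    have htr : Traps W (regionInd W i v + regionInd W (i + 1) v) (i + 4) :=
      hW.traps_of_chain_sub ((hW.region_spec i hv).1.add (hW.region_spec (i + 1) hv).1)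
      (pathArcs_subset (i + 2) v) (pathArcs_subset (i + 4) v) (fun d hd => by
        rw [Pi.add_apply, regionChain_of_inner W i v hd, regionChain_of_inner W (i + 1) v hd,
          e1, e2]
        ring) (i + 4) 2 (by norm_num)
      ⟨3, by norm_num, Or.inr (by norm_num), by rw [add_assoc]; congr 1⟩
      ⟨2, by norm_num, by norm_num, by rw [add_assoc, add_assoc]; congr 1⟩
      ⟨0, by norm_num, by norm_num, by simp⟩
      ⟨0, by norm_num, by norm_num, by rw [add_assoc, add_assoc]; congr 1⟩
    rcases hend (htr.le_max_of_mem_pathArcs hW (hcorner (i + 1)) he) with h | h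
    · exact ⟨i, Or.inl rfl, h⟩
    · exact ⟨i + 1, Or.inr (Or.inl rfl), h⟩
  · have e1 : i + 4 + 2 = i + 1 := by rw [add_assoc]; congr 1
    have e2 : i + 4 + 3 = i + 2 := by rw [add_assoc]; congr 1
    have htr : Traps W (regionInd W i v + regionInd W (i + 4) v) (i + 1) :=
      hW.traps_of_chain_sub ((hW.region_spec i hv).1.add (hW.region_spec (i + 4) hv).1)
      (pathArcs_subset (i + 1) v) (pathArcs_subset (i + 3) v) (fun d hd => by
        rw [Pi.add_apply, regionChain_of_inner W i v hd, regionChain_of_inner W (i + 4) v hd,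
          e1, e2]
        ring) (i + 1) 3 (by norm_num)
      ⟨0, by norm_num, Or.inl rfl, by simp⟩
      ⟨4, by norm_num, by norm_num, by rw [add_assoc, add_assoc]; congr 1⟩
      ⟨2, by norm_num, by norm_num, by rw [add_assoc]; congr 1⟩
      ⟨2, by norm_num, by norm_num, by
        rw [add_assoc, add_assoc]; congr 1⟩
    rcases hend (htr.le_max_of_mem_pathArcs hW (hcorner (i + 4)) he) with h | h
    · exact ⟨i, Or.inl rfl, h⟩
    · exact ⟨i + 4, Or.inr (Or.inr rfl), h⟩

theorem regionFaces_ssubset {i : ZMod 5} {u v : T.Vertex} (hv : ¬T.IsOuterVertex v)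
    (hu' : ¬T.IsOuterVertex u) (huv : u ≠ v) (hu : u ∈ T.regionVertices W i v) :
    T.regionFaces W i u ⊂ T.regionFaces W i v := by
  have h3 : i + 2 + 1 = i + 3 := by rw [add_assoc]; congr 1
  have hsub : T.regionFaces W i u ⊆ T.regionFaces W i v := by
    have key := fun e => hW.side_mem_of_path hv hu (e := e)
    rw [regionFaces_of_inner W i hv] at key ⊢
    rw [regionFaces_of_inner W i hu']
    refine enclosedFaces_mono fun e he => ?_
    rw [regionContour, sub_two_eq] at he
    rcases he with (he | he) | he
    · exact Or.inl (Or.inl (Or.inl he))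
    · exact Or.inr (key e (Or.inr he))
    · exact Or.inr (key e (Or.inl he))
  refine hsub.ssubset_of_ne fun heq => huv ?_
  have hind : regionInd W i u = regionInd W i v := by rw [regionInd, heq, regionInd]
  have hchain : ∀ d, regionChain W i u d = regionChain W i v d := by
    intro d
    have e1 := (hW.region_spec i hu').1 d
    have e2 := (hW.region_spec i hv).1 d
    rw [hind] at e1
    linarith
  have hC := hW.isSimpleCycle_orientedContour (i + 2) hv
  -- both arcs at the corner `v` of the contour belong to the paths from `u`, so that `v = u`
  have ha := hW.out_spec (i + 2) hv
  have hb := hW.out_spec (i + 3) hv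
  have hmem1 : out W (i + 2) v ∈ T.pathArcs W (i + 2) u := by
    have h1 : regionChain W i v (out W (i + 2) v) = 1 := by
      have hm : out W (i + 2) v ∈ orientedContour W (i + 2) v :=
        Or.inl (Or.inl (hW.out_mem_pathArcs _ hv))
      rw [← hW.chain_orientedContour i hv, T.chain_of_mem hm (hC.rev_notMem _ hm)]
    rw [← hchain, regionChain_of_inner W i u (by rwa [ha.2])] at h1
    refine (mem_or_of_chain_sub_pos (by rw [h1]; norm_num)).resolve_right fun h => ?_
    rcases hW.color_rev ha.1 h.1 with h' | h' <;> rw [add_assoc] at h' <;>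
      exact absurd (add_left_cancel h') (by decide)
  have hmem2 : out W (i + 3) v ∈ T.pathArcs W (i + 3) u := by
    have h1 : regionChain W i v (out W (i + 3) v) = -1 := by
      have hm : T.rev (out W (i + 3) v) ∈ orientedContour W (i + 2) v :=
        Or.inr (by
          rw [Set.mem_preimage, T.rev_rev, h3]
          exact hW.out_mem_pathArcs _ hv)
      rw [← hW.chain_orientedContour i hv, ← T.rev_rev (out W (i + 3) v), T.chain_rev,
        T.chain_of_mem hm (hC.rev_notMem _ hm)]
    rw [← hchain, regionChain_of_inner W i u (by rwa [hb.2])] at h1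
    refine (mem_or_of_chain_sub_pos (A := T.pathArcs W (i + 3) u) (B := T.pathArcs W (i + 2) u)
      (by linarith)).resolve_right fun h => ?_
    rcases hW.color_rev hb.1 h.1 with h' | h' <;> rw [add_assoc] at h' <;>
      exact absurd (add_left_cancel h') (by decide)
  obtain ⟨k, hk, -⟩ := hW.exists_iterate_of_mem hmem1
  obtain ⟨m, hm, -⟩ := hW.exists_iterate_of_mem hmem2
  rw [ha.2] at hk
  rw [hb.2] at hm
  have := hW.eq_of_iterate_eq (i + 2) hu' (k := k) (m := m) (by rw [← hk, h3, ← hm])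
  rw [hk, this]

/-- The union of the regions `R_{i+2}` and `R_{i-2}` grows when one moves from `v` to a vertex
of `R_i(v)`. -/
theorem regionFaces_subset_union {i : ZMod 5} {u v : T.Vertex} (hv : ¬T.IsOuterVertex v)
    (hu' : ¬T.IsOuterVertex u) (hu : u ∈ T.regionVertices W i v) {j : ZMod 5}
    (hj : j = i + 2 ∨ j = i + 3) {f : T.Face} (hf : f ∈ T.regionFaces W j v) :
    f ∈ T.regionFaces W (i + 2) u ∨ f ∈ T.regionFaces W (i + 3) u := by
  set z := regionInd W (i + 2) u + regionInd W (i + 3) u with hz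
  have hzw := (hW.region_spec (i + 2) hu').1.add (hW.region_spec (i + 3) hu').1
  obtain ⟨hvw, hstart, hreach⟩ := hW.region_spec j hv
  have hdisj : ∀ g ∈ T.regionFaces W j v, ∀ k, (k = i ∨ k = i + 1 ∨ k = i + 4) →
      g ∉ T.regionFaces W k v := by
    rintro g hg k hk
    refine hW.regionFaces_disjoint hv (fun h => ?_) hg
    rcases hj with rfl | rfl <;> rcases hk with rfl | rfl | rfl
    · exact absurd (add_eq_left.1 h) (by decide)
    · exact absurd (add_left_cancel h) (by decide)
    · exact absurd (add_left_cancel h) (by decide)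
    · exact absurd (add_eq_left.1 h) (by decide)
    · exact absurd (add_left_cancel h) (by decide)
    · exact absurd (add_left_cancel h) (by decide)
  have key : ∀ g, Relation.ReflTransGen (T.DualStep (T.regionContour W j v))
      (T.leftFace (T.rev (T.outer (j + 2)))) g →
      g ∈ T.regionFaces W j v ∧ z g = z (T.leftFace (T.rev (T.outer (j + 2)))) := by
    intro g hg
    induction hg with
    | refl => exact ⟨hstart, rfl⟩
    | tail _ hs ih =>
      obtain ⟨d, h1, h2, rfl, rfl⟩ := hs
      obtain ⟨ih1, ih2⟩ := ih
      have hside : T.leftFace (T.rev d) ∈ T.regionFaces W j v := by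
        rw [regionFaces_of_inner W j hv] at ih1 ⊢
        exact fun h => ih1 (h.tail ⟨T.rev d, h2, by rwa [T.rev_rev], rfl, by rw [T.rev_rev]⟩)
      refine ⟨hside, ?_⟩
      have hnot : ∀ e, (e = d ∨ e = T.rev d) →
          e ∉ T.pathArcs W (i + 4) u ∧ e ∉ T.pathArcs W (i + 1) u ∧ ∀ k, e ≠ T.outer k := by
        intro e he
        have hboth : T.leftFace e ∈ T.regionFaces W j v ∧
            T.leftFace (T.rev e) ∈ T.regionFaces W j v := by
          rcases he with rfl | rfl
          · exact ⟨ih1, hside⟩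
          · rw [T.rev_rev]; exact ⟨hside, ih1⟩
        have hno : ¬(e ∈ T.pathArcs W (i + 4) u ∨ e ∈ T.pathArcs W (i + 1) u) := by
          intro h
          obtain ⟨k, hk, hk' | hk'⟩ := hW.side_mem_of_path' hv hu h
          · exact hdisj _ hboth.1 k hk hk'
          · exact hdisj _ hboth.2 k hk hk'
        rw [not_or] at hno
        refine ⟨hno.1, hno.2, ?_⟩
        rintro k rfl
        rw [T.leftFace_outer] at hboth
        exact outerFace_notMem_regionFaces W j v hboth.1
      obtain ⟨a1, a2, a3⟩ := hnot d (Or.inl rfl)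
      obtain ⟨b1, b2, b3⟩ := hnot _ (Or.inr rfl)
      have c1 : i + 2 + 2 = i + 4 := by rw [add_assoc]; congr 1
      have c2 : i + 3 + 3 = i + 1 := by rw [add_assoc]; congr 1
      have c3 : i + 2 + 3 = i + 3 + 2 := by rw [add_assoc, add_assoc]; congr 1
      have hz0 := hzw d
      rw [← ih2, hz, hz0, Pi.add_apply, regionChain, regionChain]
      simp only [Pi.add_apply, Pi.sub_apply]
      rw [c1, c2, c3, T.chain_of_notMem a1 b1, T.chain_of_notMem a2 b2,
        T.chain_of_notMem (C := {T.outer (i + 4)}) (a3 _) (b3 _),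
        T.chain_of_notMem (C := {T.outer (i + 3 + 2)}) (a3 _) (b3 _)]
      ring
  have hz1 : 1 ≤ z (T.leftFace (T.rev (T.outer (j + 2)))) := by
    rw [hz, Pi.add_apply]
    rcases hj with rfl | rfl
    · rw [regionInd_of_mem (hW.region_spec (i + 2) hu').2.1]
      linarith [regionInd_nonneg W (i + 3) u (T.leftFace (T.rev (T.outer (i + 2 + 2))))]
    · rw [regionInd_of_mem (hW.region_spec (i + 3) hu').2.1]
      linarith [regionInd_nonneg W (i + 2) u (T.leftFace (T.rev (T.outer (i + 3 + 2))))]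
  by_contra! hcon
  have h := (key f (hreach f hf)).2
  rw [hz, Pi.add_apply, regionInd_of_notMem hcon.1, regionInd_of_notMem hcon.2, ← hz] at h
  linarith

end IsFiveCWood
end PentagonTriangulation

/-! ### Numbers of faces -/

namespace PentagonTriangulation

variable {D : Type*} {T : PentagonTriangulation D}

theorem ncard_regionFaces_eq_sum [Fintype T.Face] (W : ZMod 5 → Set D) (i : ZMod 5)
    (x : T.Vertex) : ((T.regionFaces W i x).ncard : ℝ) = ∑ f, regionInd W i x f := by
  classical
  rw [Set.ncard_eq_toFinset_card', regionInd]
  simp [Set.indicator_apply]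

theorem regionFaces_outerVertex_self (W : ZMod 5 → Set D) (i : ZMod 5) :
    T.regionFaces W i (T.outerVertex i) = {T.outerFace}ᶜ := by
  rw [regionFaces, if_pos rfl]; rfl

theorem regionFaces_outerVertex_of_ne (W : ZMod 5 → Set D) {i k : ZMod 5} (h : k ≠ i) :
    T.regionFaces W i (T.outerVertex k) = ∅ := by
  rw [regionFaces, if_neg (fun h' => h (T.outerVertex_injective h')),
    if_pos (T.isOuterVertex_outerVertex k)]

namespace IsFiveCWood

variable {W : ZMod 5 → Set D} (hW : T.IsFiveCWood W)

include hW

theorem sum_ncard_regionFaces (x : T.Vertex) :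
    ∑ i, (T.regionFaces W i x).ncard = (({T.outerFace}ᶜ : Set T.Face)).ncard := by
  by_cases hx : T.IsOuterVertex x
  · obtain ⟨k, rfl⟩ := hx
    rw [Finset.sum_eq_single k (fun i _ hik => by
      rw [regionFaces_outerVertex_of_ne W (Ne.symm hik), Set.ncard_empty])
      (fun h => absurd (Finset.mem_univ k) h), regionFaces_outerVertex_self]
  · classical
    have := T.finite
    have : Finite T.Face := Quotient.finite _
    have := Fintype.ofFinite T.Face
    have key : ((∑ i, (T.regionFaces W i x).ncard : ℕ) : ℝ) =
        (({T.outerFace}ᶜ : Set T.Face)).ncard := by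
      push_cast
      simp only [ncard_regionFaces_eq_sum]
      rw [Finset.sum_comm, ← Finset.sum_compl_add_sum {T.outerFace}, Finset.sum_congr rfl
        (g := fun _ => (1 : ℝ)) (fun f hf => hW.sum_regionInd hx (by simpa using hf)),
        Finset.sum_singleton, Finset.sum_eq_zero (fun i _ =>
          regionInd_of_notMem (outerFace_notMem_regionFaces W i x)), Set.ncard_eq_toFinset_card']
      simp
    exact_mod_cast key

theorem ncard_regionFaces_pos {x : T.Vertex} (hx : ¬T.IsOuterVertex x) (i : ZMod 5) :
    0 < (T.regionFaces W i x).ncard := by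
  have := T.finite
  have : Finite T.Face := Quotient.finite _
  exact (Set.ncard_pos).2 ⟨_, (hW.region_spec i hx).2.1⟩

/-- An outer vertex in the region `R_i(v)` of an inner vertex is `v_{i+2}` or `v_{i-2}`. -/
theorem eq_of_outerVertex_mem {i k : ZMod 5} {v : T.Vertex} (hv : ¬T.IsOuterVertex v)
    (hk : T.outerVertex k ∈ T.regionVertices W i v) : k = i + 2 ∨ k = i + 3 := by
  by_contra! hcon
  obtain ⟨d, hd, hd'⟩ := hW.exists_corner_of_mem_regionVertices hv hk
  rw [winding_at_outer (hW.region_spec i hv).1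
    (regionInd_of_notMem (outerFace_notMem_regionFaces W i v)) hd fun e he => ?_] at hd'
  · norm_num at hd'
  · have hpath : ∀ j, k ≠ j → T.chain (T.pathArcs W j v) e = 0 := fun j hj =>
      T.chain_of_notMem (fun h => hW.w0_start j e h.1 ⟨k, he⟩) fun h =>
        hj (hW.w0_end k j _ h.1 (by rw [T.target_rev, he])).symm
    have hout : T.chain {T.outer (i + 2)} e = 0 := by
      refine T.chain_of_notMem (fun h => ?_) fun h => ?_
      · rw [Set.mem_singleton_iff.1 h] at he
        exact hcon.1 (T.outerVertex_injective he.symm)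
      · rw [← T.target_rev, Set.mem_singleton_iff.1 h, T.target_outer, add_assoc] at he
        refine hcon.2 ((T.outerVertex_injective he.symm).trans ?_)
        congr 1
    rw [regionChain, Pi.add_apply, Pi.sub_apply, hpath _ hcon.1, hpath _ hcon.2, hout]
    norm_num

/-- The two inequalities that determine the direction of the displacement from `v` to `u`. -/
theorem ncard_regionFaces_compare {i : ZMod 5} {u v : T.Vertex} (huv : u ≠ v)
    (hu : u ∈ T.regionVertices W i v) :
    (T.regionFaces W i u).ncard < (T.regionFaces W i v).ncard ∧
      (T.regionFaces W (i + 2) v).ncard + (T.regionFaces W (i + 3) v).ncard ≤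
        (T.regionFaces W (i + 2) u).ncard + (T.regionFaces W (i + 3) u).ncard := by
  classical
  have := T.finite
  have : Finite T.Face := Quotient.finite _
  have := Fintype.ofFinite T.Face
  have h2 : i ≠ i + 2 := fun h => absurd (left_eq_add.1 h) (by decide)
  have h3 : i ≠ i + 3 := fun h => absurd (left_eq_add.1 h) (by decide)
  have h23 : i + 2 ≠ i + 3 := fun h => absurd (add_left_cancel h) (by decide)
  have htotal := hW.sum_ncard_regionFaces
  have hpair : ∀ x, ∀ j k : ZMod 5, j ≠ k → (T.regionFaces W j x).ncard +
      (T.regionFaces W k x).ncard ≤ (({T.outerFace}ᶜ : Set T.Face)).ncard := by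
    intro x j k hjk
    rw [← htotal x, ← Finset.sum_pair (f := fun l => (T.regionFaces W l x).ncard) hjk]
    exact Finset.sum_le_sum_of_subset (Finset.subset_univ _)
  by_cases hv : T.IsOuterVertex v
  · have hvi : v = T.outerVertex i := by
      by_contra hne
      rw [regionVertices, if_neg hne, if_pos hv] at hu
      exact huv hu
    subst hvi
    rw [regionFaces_outerVertex_self, regionFaces_outerVertex_of_ne W h2,
      regionFaces_outerVertex_of_ne W h3, Set.ncard_empty]
    refine ⟨?_, Nat.zero_le _⟩
    by_cases hu' : T.IsOuterVertex u
    · obtain ⟨k, rfl⟩ := hu'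
      rw [regionFaces_outerVertex_of_ne W (fun h => huv (by rw [h])), Set.ncard_empty]
      exact (Set.ncard_pos).2 ⟨_, T.leftFace_rev_outer_ne 0⟩
    · have := hpair u i (i + 2) h2
      have := hW.ncard_regionFaces_pos hu' (i + 2)
      omega
  by_cases hu' : T.IsOuterVertex u
  · obtain ⟨k, rfl⟩ := hu'
    have hk := hW.eq_of_outerVertex_mem hv hu
    have hki : k ≠ i := by
      rcases hk with rfl | rfl
      · exact h2.symm
      · exact h3.symm
    rw [regionFaces_outerVertex_of_ne W hki, Set.ncard_empty]
    refine ⟨hW.ncard_regionFaces_pos hv i, (hpair v _ _ h23).trans ?_⟩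
    rcases hk with rfl | rfl
    · rw [regionFaces_outerVertex_self]; exact Nat.le_add_right _ _
    · rw [regionFaces_outerVertex_self]; exact Nat.le_add_left _ _
  · refine ⟨Set.ncard_lt_ncard (hW.regionFaces_ssubset hv hu' huv hu), ?_⟩
    rw [← Set.ncard_union_eq (Set.disjoint_left.2 fun f => hW.regionFaces_disjoint hv h23)]
    refine (Set.ncard_le_ncard ?_).trans (Set.ncard_union_le _ _)
    rintro f (hf | hf)
    · exact hW.regionFaces_subset_union hv hu' hu (Or.inl rfl) hf
    · exact hW.regionFaces_subset_union hv hu' hu (Or.inr rfl) hf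

end IsFiveCWood

theorem five_le_card_vertex : 5 ≤ Nat.card T.Vertex := by
  have := T.finite
  have : Finite T.Vertex := Quotient.finite _
  have h := Nat.card_le_card_of_injective _ T.outerVertex_injective
  rwa [Nat.card_zmod] at h

end PentagonTriangulation

/-! ### The regular pentagon -/

theorem ZMod.sum_five_shift (f : ZMod 5 → ℝ) (i : ZMod 5) :
    ∑ j, f j = f i + f (i + 1) + f (i + 2) + f (i + 3) + f (i + 4) := by
  rw [← Equiv.sum_comp (Equiv.addLeft i) f]
  have : ∀ g : ZMod 5 → ℝ, ∑ j, g j = g 0 + g 1 + g 2 + g 3 + g 4 := fun g => Fin.sum_univ_five g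
  rw [this]
  simp

/-- In a regular pentagon with vertices `p_1, ..., p_5` and center `c`, the inner product of
`p_i - c` and `p_{i+m} - c` is `r² cos (2πm/5)`. -/
theorem IsClockwiseRegularPentagon.exists_inner {p : ZMod 5 → ℂ} {c : ℂ}
    (hp : IsClockwiseRegularPentagon p c) :
    ∃ r > 0, ∀ i m, inner ℝ (p i - c) (p (i + m) - c) =
      r * Real.cos (2 * Real.pi * (m.val : ℝ) / 5) := by
  obtain ⟨w, hw, hp⟩ := hp
  set ζ := Complex.exp (-(2 * Real.pi / 5 : ℝ) * Complex.I) with hζ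
  have hpow : ∀ n : ℕ, ζ ^ n = Complex.exp (-(2 * Real.pi * (n : ℝ) / 5 : ℝ) * Complex.I) := by
    intro n
    rw [hζ, ← Complex.exp_nat_mul]
    congr 1
    push_cast
    ring
  have h5 : ζ ^ 5 = 1 := by
    rw [hpow, Complex.exp_eq_one_iff]
    exact ⟨-1, by push_cast; ring⟩
  have hnorm : ∀ n : ℕ, ‖ζ ^ n‖ = 1 := by
    intro n
    rw [hpow]
    have := Complex.norm_exp_ofReal_mul_I (-(2 * Real.pi * (n : ℝ) / 5))
    rwa [Complex.ofReal_neg] at this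
  have hadd : ∀ i m : ZMod 5, ζ ^ (i + m).val = ζ ^ i.val * ζ ^ m.val := by
    intro i m
    rw [ZMod.val_add, ← pow_add]
    conv_rhs => rw [← Nat.div_add_mod (i.val + m.val) 5, pow_add, pow_mul, h5, one_pow, one_mul]
  refine ⟨‖w‖ ^ 2, by positivity, fun i m => ?_⟩
  have e : ∀ k, p k - c = w * ζ ^ k.val := fun k => by rw [hp k, hpow, add_sub_cancel_left]
  rw [e, e, hadd, ← mul_assoc, Complex.inner]
  have : (w * ζ ^ i.val * ζ ^ m.val) * (starRingEnd ℂ) (w * ζ ^ i.val) =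
      ((‖w‖ ^ 2 : ℝ) : ℂ) * ζ ^ m.val := by
    have h := Complex.mul_conj (w * ζ ^ i.val)
    rw [Complex.normSq_eq_norm_sq, norm_mul, hnorm, mul_one] at h
    rw [← h]; ring
  rw [this, Complex.re_ofReal_mul, hpow,
    ← Complex.ofReal_neg, Complex.exp_ofReal_mul_I_re, Real.cos_neg]

theorem mainTheorem4 {D : Type*} (T : PentagonTriangulation D) (hT : T.IsFiveC)
    (W : ZMod 5 → Set D) (hW : T.IsFiveCWood W)
    (p : ZMod 5 → ℂ) (c : ℂ) (hp : IsClockwiseRegularPentagon p c)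
    (i : ZMod 5) (u v : T.Vertex) (huv : u ≠ v) (hu : u ∈ T.regionVertices W i v) :
    inner ℝ (p i - c) (T.drawing W p u - T.drawing W p v) < 0 := by
  obtain ⟨r, hr, hinner⟩ := hp.exists_inner
  obtain ⟨hlt, hle⟩ := hW.ncard_regionFaces_compare huv hu
  have hpos : (0 : ℝ) < 2 * (Nat.card T.Vertex : ℝ) - 7 := by
    have h5 : (5 : ℝ) ≤ Nat.card T.Vertex := by exact_mod_cast T.five_le_card_vertex
    linarith
  set β : ZMod 5 → ℝ := fun j => T.weight W j u - T.weight W j v with hβ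
  have hβ_eq : ∀ j, β j = (((T.regionFaces W j u).ncard : ℝ) - (T.regionFaces W j v).ncard) /
      (2 * (Nat.card T.Vertex : ℝ) - 7) := fun j => by
    simp only [hβ, PentagonTriangulation.weight]; ring
  have hsum : ∑ j, β j = 0 := by
    simp only [hβ_eq, ← Finset.sum_div, Finset.sum_sub_distrib]
    rw [← Nat.cast_sum, ← Nat.cast_sum, hW.sum_ncard_regionFaces, hW.sum_ncard_regionFaces,
      sub_self, zero_div]
  have hβi : β i < 0 := by
    rw [hβ_eq]
    refine div_neg_of_neg_of_pos ?_ hpos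
    rw [sub_neg]
    exact_mod_cast hlt
  have hβ23 : 0 ≤ β (i + 2) + β (i + 3) := by
    rw [hβ_eq, hβ_eq, ← add_div]
    refine div_nonneg ?_ hpos.le
    have : ((T.regionFaces W (i + 2) v).ncard : ℝ) + (T.regionFaces W (i + 3) v).ncard ≤
        (T.regionFaces W (i + 2) u).ncard + (T.regionFaces W (i + 3) u).ncard := by
      exact_mod_cast hle
    linarith
  have hdiff : T.drawing W p u - T.drawing W p v = ∑ j, β j • (p j - c) := by
    simp only [smul_sub, Finset.sum_sub_distrib, ← Finset.sum_smul, hsum, zero_smul, sub_zero]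
    simp only [PentagonTriangulation.drawing, hβ, sub_smul, Finset.sum_sub_distrib]
  rw [hdiff, inner_sum]
  simp only [inner_smul_right]
  rw [ZMod.sum_five_shift (fun j => β j * inner ℝ (p i - c) (p j - c)) i]
  have h0 := hinner i 0
  rw [add_zero] at h0
  rw [ZMod.sum_five_shift β i] at hsum
  have hπ := Real.pi_pos
  have v0 : (0 : ZMod 5).val = 0 := rfl
  have v1 : (1 : ZMod 5).val = 1 := rfl
  have v2 : (2 : ZMod 5).val = 2 := rfl
  have v3 : (3 : ZMod 5).val = 3 := rfl
  have v4 : (4 : ZMod 5).val = 4 := rfl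
  have c0 : Real.cos (2 * Real.pi * ((0 : ℕ) : ℝ) / 5) = 1 := by simp
  have c3 : Real.cos (2 * Real.pi * ((3 : ℕ) : ℝ) / 5) =
      Real.cos (2 * Real.pi * ((2 : ℕ) : ℝ) / 5) := by
    rw [← Real.cos_two_pi_sub]; congr 1; push_cast; ring
  have c4 : Real.cos (2 * Real.pi * ((4 : ℕ) : ℝ) / 5) =
      Real.cos (2 * Real.pi * ((1 : ℕ) : ℝ) / 5) := by
    rw [← Real.cos_two_pi_sub]; congr 1; push_cast; ring
  have hc1 : Real.cos (2 * Real.pi * ((1 : ℕ) : ℝ) / 5) < 1 := by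
    rw [← Real.cos_zero]
    exact Real.cos_lt_cos_of_nonneg_of_le_pi le_rfl (by push_cast; linarith)
      (by push_cast; positivity)
  have hc2 : Real.cos (2 * Real.pi * ((2 : ℕ) : ℝ) / 5) <
      Real.cos (2 * Real.pi * ((1 : ℕ) : ℝ) / 5) :=
    Real.cos_lt_cos_of_nonneg_of_le_pi (by positivity) (by push_cast; linarith)
      (by push_cast; linarith)
  rw [h0, hinner, hinner, hinner, hinner, v0, v1, v2, v3, v4, c0, c3, c4]
  set a := Real.cos (2 * Real.pi * ((1 : ℕ) : ℝ) / 5)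
  set b := Real.cos (2 * Real.pi * ((2 : ℕ) : ℝ) / 5)
  have h14 : β (i + 1) + β (i + 4) = -β i - (β (i + 2) + β (i + 3)) := by linarith
  -- the sum of the `β j` vanishes, so the neighbors of `i` can be eliminated
  have hfinal : β i * (r * 1) + β (i + 1) * (r * a) + β (i + 2) * (r * b) + β (i + 3) * (r * b) +
      β (i + 4) * (r * a) = r * (β i * (1 - a) - (β (i + 2) + β (i + 3)) * (a - b)) := by
    linear_combination r * a * h14
  rw [hfinal]
  refine mul_neg_of_pos_of_neg hr ?_
  have e1 : β i * (1 - a) < 0 := mul_neg_of_neg_of_pos hβi (by linarith)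
  have e2 : 0 ≤ (β (i + 2) + β (i + 3)) * (a - b) := mul_nonneg hβ23 (by linarith)
  linarith
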